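/- Let $k$ be an algebraically closed field, let $1\le g\le n$ be integers, and let $K$ be the quiver with vertices $0,1,\dots,n$ (read modulo $n+1$) and arrows $\beta_x:x\to x+1$ for $0\le x\le g-1$ and $\alpha_x:x+1\to x$ for $g\le x\le n$. For integers $p\le q$ with $0\le p\le n$ let $V_{(p,q)}$ be the representation of $K$ over $k$ whose space at $x$ has as basis the symbols $e_i$ with $p\le i\le q$ and $i\equiv x \pmod{n+1}$, where each $\beta_x$ sends $e_i$ to $e_{i+1}$ if $i<q$ and $e_q$ to $0$, and each $\alpha_x$ sends $e_i$ to $e_{i-1}$ if $i>p$ and $e_p$ to $0$. For arbitrary integers $p\le q$ put $V_{(p,q)}:=V_{(p',q')}$ with $p'\in\{0,\dots,n\}$, $p'\equiv p\pmod{n+1}$, $q'=q+p'-p$. Call $(p,q)$ and $V_{(p,q)}$ post-projective if $p\equiv 1,\dots,g$ and $q\equiv g,\dots,n\pmod{n+1}$, and let $P$ be the category with objects the post-projective $V_{(p,q)}$ and with all morphisms of representations. Let $\tilde K$ be the quiver with vertex set $\mathbb Z$ and arrows $\alpha_i:i\to i+1$ for $i\equiv g,\dots,n$ and $\beta_i:i+1\to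 i$ for $i\equiv 0,\dots,g-1\pmod{n+1}$. Let $\mathbb N\tilde K$ be the quiver with vertices $(r,s)\in\mathbb N\times\mathbb Z$ and, for every arrow $\gamma:i\to j$ of $\tilde K$ and every $r\in\mathbb N$, arrows $(r,\gamma):(r,i)\to(r,j)$ and $(r,\gamma'):(r,j)\to(r+1,i)$. Let $k\mathbb N\tilde K$ be its $k$-linear path category, and let $k(\mathbb N\tilde K)=k\mathbb N\tilde K/J$, where $J$ is the ideal generated by all $\gamma'\gamma-\delta'\delta$ for arrows $X\xrightarrow{\gamma}Y_1\xrightarrow{\gamma'}Z$ and $X\xrightarrow{\delta}Y_2\xrightarrow{\delta'}Z$ with $Y_1\neq Y_2$. For a vertex $(r,s)$ of $\mathbb N\tilde K$, the longest path ending at $(r,s)$ composed of arrows $(l,i)\to(l',i+1)$ starts at a vertex $(0,p)$, and the longest path ending at $(r,s)$ composed of arrows $(l,i)\to(l',i-1)$ starts at a vertex $(0,q)$; put $F(r,s):=V_{(p,q)}$, which is post-projective. If $X\to Y$ is an arrow of $\mathbb N\tilde K$, and $(p,q)$, $(p_1,q_1)$ are the pairs so attached to $X$ and $Y$, then $p_1\le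 p\le q\le q_1$, and $F$ sends the arrow to the morphism $V_{(p,q)}\to V_{(p_1,q_1)}$ with $e_t\mapsto e_t$ for $p\le t\le q$, where the $e_t$ are indexed by the pairs $(p,q)$ and $(p_1,q_1)$ themselves, before they are shifted to $0\le p\le n$. This defines a $k$-linear functor $F:k\mathbb N\tilde K\to P$ that annihilates $J$, and hence a $k$-linear functor $\overline F:k(\mathbb N\tilde K)\to P$. **Proposition.** For every post-projective $V_{(p,q)}\in P$ and every vertex $Y$ of $\mathbb N\tilde K$, the $k$-linear map $$\bigoplus_{\overline F X=V_{(p,q)}}\operatorname{Hom}_{k(\mathbb N\tilde K)}(X,Y)\longrightarrow\operatorname{Hom}_P(V_{(p,q)},\overline F Y),\qquad (\mu_X)_X\longmapsto\sum_{X}\overline F\mu_X,$$ where $X$ runs over all vertices of $\mathbb N\tilde K$ with $\overline F X=V_{(p,q)}$, is an isomorphism. -/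

import Mathlib

open CategoryTheory

universe u

namespace AffineA

/-! ### The quiver `K` of type `Ã_n` and its representations -/

/-- The vertices `0, …, n` of the quiver `K`, read modulo `n + 1`; the parameter `g` (the number
of clockwise arrows) fixes the orientation. -/
@[nolint unusedArguments]
def KVertex (n _g : ℕ) : Type := ZMod (n + 1)

/-- The arrows of `K`: `β_x : x → x + 1` for `0 ≤ x ≤ g - 1` and `α_x : x + 1 → x` for
`g ≤ x ≤ n`, where the vertex `n + 1` is the vertex `0`. -/
inductive KArrow (n g : ℕ) : ZMod (n + 1) → ZMod (n + 1) → Type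
  | beta (x : ZMod (n + 1)) (hx : x.val < g) : KArrow n g x (x + 1)
  | alpha (x : ZMod (n + 1)) (hx : g ≤ x.val) : KArrow n g (x + 1) x

instance (n g : ℕ) : Quiver (KVertex n g) where
  Hom x y := KArrow n g x y

/-- Representations of `K` over `k`, as functors from the path category of `K` to `k`-vector
spaces: such a functor is freely determined by a vector space for every vertex and a linear map
for every arrow, and a natural transformation is a family of linear maps that commutes with the
maps of all arrows. -/
abbrev Rep (k : Type u) [Field k] (n g : ℕ) := Paths (KVertex n g) ⥤ ModuleCat.{u} k

/-- The indices `i` with `p ≤ i ≤ q` and `i ≡ x` modulo `n + 1`. -/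
abbrev Slot (n : ℕ) (p q : ℤ) (x : ZMod (n + 1)) : Type :=
  {i : ℤ // p ≤ i ∧ i ≤ q ∧ (i : ZMod (n + 1)) = x}

/-- The basis vector `e_i` of the space at `x` spanned by the `e_j` with `p ≤ j ≤ q` and `j ≡ x`;
it is `0` by convention when `i` is not one of these indices. -/
noncomputable def basisVec (k : Type u) [Field k] (n : ℕ) (p q : ℤ) (x : ZMod (n + 1)) (i : ℤ) :
    Slot n p q x →₀ k :=
  open Classical in
  if h : p ≤ i ∧ i ≤ q ∧ (i : ZMod (n + 1)) = x then Finsupp.single ⟨i, h⟩ 1 else 0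

/-- The linear maps of the arrows of `K` on the spaces with bases `e_i`, `p ≤ i ≤ q`:
`β_x` sends `e_i` to `e_{i+1}` if `i < q` and to `0` if `i = q`, and `α_x` sends `e_i` to
`e_{i-1}` if `i > p` and to `0` if `i = p`. -/
noncomputable def arrowMap (k : Type u) [Field k] {n g : ℕ} (p q : ℤ) :
    {x y : ZMod (n + 1)} → KArrow n g x y → ((Slot n p q x →₀ k) →ₗ[k] (Slot n p q y →₀ k))
  | _, _, .beta x _ => Finsupp.linearCombination k fun i : Slot n p q x =>
      if i.1 < q then basisVec k n p q (x + 1) (i.1 + 1) else 0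
  | _, _, .alpha x _ => Finsupp.linearCombination k fun i : Slot n p q (x + 1) =>
      if p < i.1 then basisVec k n p q x (i.1 - 1) else 0

/-- The representation with basis `e_p, …, e_q`, without normalisation of `p`. -/
noncomputable def rawWalkRep (k : Type u) [Field k] (n g : ℕ) (p q : ℤ) : Rep k n g :=
  Paths.lift
    { obj := fun x => ModuleCat.of k (Slot n p q x →₀ k)
      map := fun γ => ModuleCat.ofHom (arrowMap k p q γ) }

/-- The representation `V_(p,q)`: for arbitrary `p` it is, by definition, the representation
attached to the walk `(p', q')` with `0 ≤ p' ≤ n`, `p' ≡ p` modulo `n + 1` and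
`q' = q + p' - p`. -/
noncomputable def walkRep (k : Type u) [Field k] (n g : ℕ) (p q : ℤ) : Rep k n g :=
  rawWalkRep k n g (p % (n + 1 : ℕ)) (q + p % (n + 1 : ℕ) - p)

/-- The representations `V_(p,q)` are finite-dimensional. -/
lemma walkRep_finite (k : Type u) [Field k] (n g : ℕ) (p q : ℤ) (x : KVertex n g) :
    Module.Finite k ((walkRep k n g p q).obj ((Paths.of _).obj x)) := by
  have key : ∀ (p q : ℤ) (x : ZMod (n + 1)), Module.Finite k (Slot n p q x →₀ k) := by
    intro p q x
    have : Finite (Slot n p q x) :=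
      ((Set.finite_Icc p q).subset fun i hi => ⟨hi.1, hi.2.1⟩ :
        {i : ℤ | p ≤ i ∧ i ≤ q ∧ (i : ZMod (n + 1)) = x}.Finite)
    infer_instance
  exact key _ _ x

/-- Post-projective walks: pairs `(p, q)` with `p ≤ q`, `p ≡ 1, …, g` and `q ≡ g, …, n`
modulo `n + 1`. -/
def IsPostProjectiveWalk (n g : ℕ) (p q : ℤ) : Prop :=
  p ≤ q ∧ (∃ a : ℤ, 1 ≤ a ∧ a ≤ g ∧ p ≡ a [ZMOD (n + 1 : ℕ)]) ∧
    (∃ b : ℤ, g ≤ b ∧ b ≤ n ∧ q ≡ b [ZMOD (n + 1 : ℕ)])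

/-- The post-projective representations `V_(p,q)`. -/
def isPostProjective (k : Type u) [Field k] (n g : ℕ) : ObjectProperty (Rep k n g) :=
  fun V => ∃ p q : ℤ, IsPostProjectiveWalk n g p q ∧ V = walkRep k n g p q

/-- The category `P` whose objects are the post-projectives `V_(p,q)` and whose morphisms are all
morphisms of representations. -/
abbrev PostProj (k : Type u) [Field k] (n g : ℕ) := (isPostProjective k n g).FullSubcategory

/-- `V_(p,q)` as an object of `P`. -/
noncomputable def postProj (k : Type u) [Field k] (n g : ℕ) (p q : ℤ)
    (h : IsPostProjectiveWalk n g p q) : PostProj k n g :=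
  ⟨walkRep k n g p q, p, q, h, rfl⟩

/-! ### The quivers `K̃` and `ℕK̃` -/

/-- The vertices of `K̃`: all integers. -/
@[nolint unusedArguments]
def KTilde (_n _g : ℕ) : Type := ℤ

/-- The arrows of `K̃`: `α_i : i → i + 1` for `i ≡ g, …, n` and `β_i : i + 1 → i` for
`i ≡ 0, …, g - 1` modulo `n + 1`. -/
inductive KTildeArrow (n g : ℕ) : ℤ → ℤ → Type
  | alpha (i : ℤ) (hi : (g : ℤ) ≤ i % (n + 1 : ℕ)) : KTildeArrow n g i (i + 1)
  | beta (i : ℤ) (hi : i % (n + 1 : ℕ) < (g : ℤ)) : KTildeArrow n g (i + 1) i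

instance (n g : ℕ) : Quiver (KTilde n g) where
  Hom i j := KTildeArrow n g i j

/-- The vertices `(r, s)` of `ℕK̃`, with `r ∈ ℕ` and `s ∈ ℤ`. -/
@[ext]
structure NVertex (n g : ℕ) : Type where
  r : ℕ
  s : ℤ

/-- The arrows of `ℕK̃`: for every arrow `γ : i → j` of `K̃` and every `r ∈ ℕ`, arrows
`(r, γ) : (r, i) → (r, j)` and `(r, γ') : (r, j) → (r + 1, i)`. -/
inductive NArrow (n g : ℕ) : NVertex n g → NVertex n g → Type
  | base (r : ℕ) {i j : ℤ} (γ : KTildeArrow n g i j) : NArrow n g ⟨r, i⟩ ⟨r, j⟩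
  | prime (r : ℕ) {i j : ℤ} (γ : KTildeArrow n g i j) : NArrow n g ⟨r, j⟩ ⟨r + 1, i⟩

instance (n g : ℕ) : Quiver (NVertex n g) where
  Hom X Y := NArrow n g X Y

/-! ### The `k`-category `k(ℕK̃)` -/

/-- The `k`-category `kℕK̃` of paths of `ℕK̃`: the free `k`-linear category on the path category. -/
abbrev PathAlg (k : Type u) [Field k] (n g : ℕ) := Free k (Paths (NVertex n g))

/-- The vertex `X` as an object of `kℕK̃`. -/
def PathAlg.of (k : Type u) [Field k] {n g : ℕ} (X : NVertex n g) : PathAlg k n g := X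

/-- A path of length two as a morphism of `kℕK̃`. -/
noncomputable def pathTwo (k : Type u) [Field k] {n g : ℕ} {X Y Z : NVertex n g}
    (γ : X ⟶ Y) (γ' : Y ⟶ Z) : PathAlg.of k X ⟶ PathAlg.of k Z :=
  (Free.embedding k (Paths (NVertex n g))).map
    ((Paths.of (NVertex n g)).map γ ≫ (Paths.of (NVertex n g)).map γ')

/-- The elements `γ'γ - δ'δ` for the diamonds `γ : X → Y₁`, `γ' : Y₁ → Z`, `δ : X → Y₂`,
`δ' : Y₂ → Z` of `ℕK̃`. -/
inductive IsMeshElement (k : Type u) [Field k] (n g : ℕ) :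
    {X Z : PathAlg k n g} → (X ⟶ Z) → Prop
  | mk {X Y₁ Y₂ Z : NVertex n g} (hY : Y₁ ≠ Y₂) (γ : X ⟶ Y₁) (γ' : Y₁ ⟶ Z) (δ : X ⟶ Y₂)
      (δ' : Y₂ ⟶ Z) :
      IsMeshElement k n g (X := PathAlg.of k X) (Z := PathAlg.of k Z)
        (pathTwo k γ γ' - pathTwo k δ δ')

/-- The ideal `J` of `kℕK̃` generated by the elements `γ'γ - δ'δ`. -/
noncomputable def meshIdeal (k : Type u) [Field k] (n g : ℕ) (X Y : PathAlg k n g) : Submodule k (X ⟶ Y) :=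
  Submodule.span k {f | ∃ (A B : PathAlg k n g) (a : X ⟶ A) (m : A ⟶ B) (b : B ⟶ Y),
    IsMeshElement k n g m ∧ f = a ≫ m ≫ b}

lemma comp_mem_meshIdeal {k : Type u} [Field k] {n g : ℕ} {X Y Z : PathAlg k n g} (a : X ⟶ Y)
    {f : Y ⟶ Z} (hf : f ∈ meshIdeal k n g Y Z) : a ≫ f ∈ meshIdeal k n g X Z := by
  induction hf using Submodule.span_induction with
  | mem f hf =>
    obtain ⟨A, B, c, m, b, hm, rfl⟩ := hf
    exact Submodule.subset_span ⟨A, B, a ≫ c, m, b, hm, by simp⟩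
  | zero => simp
  | add f f' _ _ h h' => rw [Preadditive.comp_add]; exact add_mem h h'
  | smul t f _ h => rw [Linear.comp_smul]; exact Submodule.smul_mem _ _ h

lemma mem_meshIdeal_comp {k : Type u} [Field k] {n g : ℕ} {X Y Z : PathAlg k n g} {f : X ⟶ Y}
    (b : Y ⟶ Z) (hf : f ∈ meshIdeal k n g X Y) : f ≫ b ∈ meshIdeal k n g X Z := by
  induction hf using Submodule.span_induction with
  | mem f hf =>
    obtain ⟨A, B, a, m, c, hm, rfl⟩ := hf
    exact Submodule.subset_span ⟨A, B, a, m, c ≫ b, hm, by simp⟩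
  | zero => simp
  | add f f' _ _ h h' => rw [Preadditive.add_comp]; exact add_mem h h'
  | smul t f _ h => rw [Linear.smul_comp]; exact Submodule.smul_mem _ _ h

/-- Two morphisms of `kℕK̃` are identified when their difference lies in `J`. -/
def meshRel (k : Type u) [Field k] (n g : ℕ) : HomRel (PathAlg k n g) :=
  fun X Y f f' => f - f' ∈ meshIdeal k n g X Y

instance (k : Type u) [Field k] (n g : ℕ) : Congruence (meshRel k n g) where
  comp_left {_ _ _} a {_ _} h := by
    have := comp_mem_meshIdeal a h
    rwa [Preadditive.comp_sub] at this
  comp_right {_ _ _ _ _} b h := by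
    have := mem_meshIdeal_comp b h
    rwa [Preadditive.sub_comp] at this
  equivalence :=
    { refl := fun f => by simp [meshRel]
      symm := fun {f f'} h => by
        have := neg_mem h
        rwa [neg_sub] at this
      trans := fun {f f' f''} h h' => by
        have := add_mem h h'
        rwa [sub_add_sub_cancel] at this }

lemma meshRel_add (k : Type u) [Field k] (n g : ℕ) ⦃X Y : PathAlg k n g⦄ (f₁ f₂ f₁' f₂' : X ⟶ Y)
    (h : meshRel k n g f₁ f₂) (h' : meshRel k n g f₁' f₂') :
    meshRel k n g (f₁ + f₁') (f₂ + f₂') := by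
  have := add_mem h h'
  rwa [sub_add_sub_comm] at this

lemma meshRel_smul (k : Type u) [Field k] (n g : ℕ) (t : k) ⦃X Y : PathAlg k n g⦄ (f₁ f₂ : X ⟶ Y)
    (h : meshRel k n g f₁ f₂) : meshRel k n g (t • f₁) (t • f₂) := by
  have := Submodule.smul_mem _ t h
  rwa [smul_sub] at this

/-- The `k`-category `k(ℕK̃) = kℕK̃ / J`. -/
abbrev MeshCat (k : Type u) [Field k] (n g : ℕ) := CategoryTheory.Quotient (meshRel k n g)

noncomputable instance (k : Type u) [Field k] (n g : ℕ) : Preadditive (MeshCat k n g) :=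
  Quotient.preadditive (meshRel k n g) (meshRel_add k n g)

instance (k : Type u) [Field k] (n g : ℕ) : (Quotient.functor (meshRel k n g)).Additive :=
  Quotient.functor_additive (meshRel k n g) (meshRel_add k n g)

noncomputable instance (k : Type u) [Field k] (n g : ℕ) : Linear k (MeshCat k n g) :=
  Quotient.linear k (meshRel k n g) (meshRel_smul k n g)

instance (k : Type u) [Field k] (n g : ℕ) : (Quotient.functor (meshRel k n g)).Linear k :=
  Quotient.linear_functor k (meshRel k n g) (meshRel_smul k n g)

/-! ### The map `F` on vertices -/

/-- The largest `p ≤ s` with `p ≡ 1, …, g`. -/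
def floorP (n g : ℕ) (s : ℤ) : ℤ :=
  if (s - 1) % (n + 1 : ℕ) < (g : ℤ) then s else s - ((s - 1) % (n + 1 : ℕ) - g + 1)

/-- The smallest `q ≥ s` with `q ≡ g, …, n`. -/
def ceilQ (n g : ℕ) (s : ℤ) : ℤ :=
  if (g : ℤ) ≤ s % (n + 1 : ℕ) then s else s + (g - s % (n + 1 : ℕ))

/-- The integer `p` such that `(0, p)` is the starting point of the path of maximal length that
ends at `(r, s)` and is composed of arrows `(l, i) → (l', i + 1)`; see `startP_spec`. On each
level such a path runs backwards to the vertex `floorP s`, and it then enters the level below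
at `floorP s - 1`. -/
def startP (n g : ℕ) : ℕ → ℤ → ℤ
  | 0, s => floorP n g s
  | r + 1, s => startP n g r (floorP n g s - 1)

/-- The integer `q` such that `(0, q)` is the starting point of the path of maximal length that
ends at `(r, s)` and is composed of arrows `(l, i) → (l', i - 1)`; see `startQ_spec`. -/
def startQ (n g : ℕ) : ℕ → ℤ → ℤ
  | 0, s => ceilQ n g s
  | r + 1, s => startQ n g r (ceilQ n g s + 1)

/-- There is an arrow `X → Y` of `ℕK̃` of the form `(l, i) → (l', i + 1)`. -/
def UpStep {n g : ℕ} (X Y : NVertex n g) : Prop := Nonempty (X ⟶ Y) ∧ Y.s = X.s + 1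

/-- There is an arrow `X → Y` of `ℕK̃` of the form `(l, i) → (l', i - 1)`. -/
def DownStep {n g : ℕ} (X Y : NVertex n g) : Prop := Nonempty (X ⟶ Y) ∧ Y.s = X.s - 1

lemma mod_add_mul_div (n : ℕ) (s : ℤ) : ∃ d : ℤ, s = (n + 1 : ℕ) * d + s % (n + 1 : ℕ) ∧
    0 ≤ s % (n + 1 : ℕ) ∧ s % (n + 1 : ℕ) < (n + 1 : ℕ) :=
  ⟨s / (n + 1 : ℕ), (Int.mul_ediv_add_emod s _).symm, Int.emod_nonneg _ (by positivity),
    Int.emod_lt_of_pos _ (by positivity)⟩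

lemma emod_of_eq (n : ℕ) {s d m : ℤ} (h : s = (n + 1 : ℕ) * d + m) (h0 : 0 ≤ m)
    (h1 : m < (n + 1 : ℕ)) : s % (n + 1 : ℕ) = m := by
  rw [h, Int.mul_add_emod_self_left, Int.emod_eq_of_lt h0 h1]

lemma mul_lt_cases (n : ℕ) (d d' : ℤ) :
    (n + 1 : ℕ) * d ≤ (n + 1 : ℕ) * d' ∨ (n + 1 : ℕ) * d' + (n + 1 : ℕ) ≤ (n + 1 : ℕ) * d := by
  rcases le_or_gt d d' with h | h
  · exact Or.inl (mul_le_mul_of_nonneg_left h (by positivity))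
  · right
    have : ((n + 1 : ℕ) : ℤ) * (d' + 1) ≤ (n + 1 : ℕ) * d :=
      mul_le_mul_of_nonneg_left (by omega) (by positivity)
    linarith

lemma floorP_le (n g : ℕ) (s : ℤ) : floorP n g s ≤ s := by
  unfold floorP; split_ifs <;> omega

lemma le_ceilQ (n g : ℕ) (s : ℤ) : s ≤ ceilQ n g s := by
  unfold ceilQ; split_ifs <;> omega

lemma floorP_mod {n g : ℕ} (hg : 1 ≤ g) (s : ℤ) :
    (floorP n g s - 1) % (n + 1 : ℕ) < (g : ℤ) := by
  unfold floorP
  split_ifs with h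
  · exact h
  · obtain ⟨d, h1, h2, h3⟩ := mod_add_mul_div n (s - 1)
    rw [emod_of_eq n (d := d) (m := g - 1)] <;> omega

lemma ceilQ_mod {n g : ℕ} (hgn : g ≤ n) (s : ℤ) :
    (g : ℤ) ≤ ceilQ n g s % (n + 1 : ℕ) := by
  unfold ceilQ
  split_ifs with h
  · exact h
  · obtain ⟨d, h1, h2, h3⟩ := mod_add_mul_div n s
    rw [emod_of_eq n (d := d) (m := g)] <;> omega

lemma le_floorP {n g : ℕ} {s t : ℤ} (hts : t ≤ s)
    (ht : (t - 1) % (n + 1 : ℕ) < (g : ℤ)) : t ≤ floorP n g s := by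
  unfold floorP
  split_ifs with h
  · exact hts
  · obtain ⟨d, h1, h2, h3⟩ := mod_add_mul_div n (s - 1)
    obtain ⟨d', h1', h2', h3'⟩ := mod_add_mul_div n (t - 1)
    rcases mul_lt_cases n d' d with h4 | h4 <;> omega

lemma ceilQ_le {n g : ℕ} {s t : ℤ} (hts : s ≤ t)
    (ht : (g : ℤ) ≤ t % (n + 1 : ℕ)) : ceilQ n g s ≤ t := by
  unfold ceilQ
  split_ifs with h
  · exact hts
  · obtain ⟨d, h1, h2, h3⟩ := mod_add_mul_div n s
    obtain ⟨d', h1', h2', h3'⟩ := mod_add_mul_div n t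
    rcases mul_lt_cases n d d' with h4 | h4 <;> omega

lemma floorP_mono {n g : ℕ} (hg : 1 ≤ g) {s t : ℤ} (h : s ≤ t) : floorP n g s ≤ floorP n g t :=
  le_floorP ((floorP_le n g s).trans h) (floorP_mod hg s)

lemma ceilQ_mono {n g : ℕ} (hgn : g ≤ n) {s t : ℤ} (h : s ≤ t) : ceilQ n g s ≤ ceilQ n g t :=
  ceilQ_le (h.trans (le_ceilQ n g t)) (ceilQ_mod hgn t)

lemma startP_mono {n g : ℕ} (hg : 1 ≤ g) (r : ℕ) {s t : ℤ} (h : s ≤ t) :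
    startP n g r s ≤ startP n g r t := by
  induction r generalizing s t with
  | zero => exact floorP_mono hg h
  | succ r ih => exact ih (by have := floorP_mono (n := n) hg h; omega)

lemma startQ_mono {n g : ℕ} (hgn : g ≤ n) (r : ℕ) {s t : ℤ} (h : s ≤ t) :
    startQ n g r s ≤ startQ n g r t := by
  induction r generalizing s t with
  | zero => exact ceilQ_mono hgn h
  | succ r ih => exact ih (by have := ceilQ_mono hgn h; omega)

lemma startP_le (n g r : ℕ) (s : ℤ) : startP n g r s ≤ s := by
  induction r generalizing s with
  | zero => exact floorP_le n g s
  | succ r ih => have := ih (floorP n g s - 1); have := floorP_le n g s; simp only [startP]; omega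

lemma le_startQ (n g r : ℕ) (s : ℤ) : s ≤ startQ n g r s := by
  induction r generalizing s with
  | zero => exact le_ceilQ n g s
  | succ r ih => have := ih (ceilQ n g s + 1); have := le_ceilQ n g s; simp only [startQ]; omega

lemma startP_mod {n g : ℕ} (hg : 1 ≤ g) (r : ℕ) (s : ℤ) :
    (startP n g r s - 1) % (n + 1 : ℕ) < (g : ℤ) := by
  induction r generalizing s with
  | zero => exact floorP_mod hg s
  | succ r ih => exact ih _

lemma startQ_mod {n g : ℕ} (hgn : g ≤ n) (r : ℕ) (s : ℤ) :
    (g : ℤ) ≤ startQ n g r s % (n + 1 : ℕ) := by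
  induction r generalizing s with
  | zero => exact ceilQ_mod hgn s
  | succ r ih => exact ih _

lemma isPostProjectiveWalk_start {n g : ℕ} (hg : 1 ≤ g) (hgn : g ≤ n) (r : ℕ) (s : ℤ) :
    IsPostProjectiveWalk n g (startP n g r s) (startQ n g r s) := by
  have hP := startP_mod (n := n) hg r s
  have hQ := startQ_mod hgn r s
  obtain ⟨d, h1, h2, h3⟩ := mod_add_mul_div n (startP n g r s - 1)
  obtain ⟨d', h1', h2', h3'⟩ := mod_add_mul_div n (startQ n g r s)
  refine ⟨(startP_le n g r s).trans (le_startQ n g r s),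
    ⟨(startP n g r s - 1) % (n + 1 : ℕ) + 1, by omega, by omega, ?_⟩,
    ⟨startQ n g r s % (n + 1 : ℕ), hQ, by omega, (Int.mod_modEq _ _).symm⟩⟩
  have := (Int.mod_modEq (startP n g r s - 1) (n + 1 : ℕ)).symm.add_right 1
  rwa [sub_add_cancel] at this

lemma upStep_base {n g : ℕ} (r : ℕ) {s : ℤ} (h : (g : ℤ) ≤ (s - 1) % (n + 1 : ℕ)) :
    UpStep (n := n) (g := g) ⟨r, s - 1⟩ ⟨r, s⟩ := by
  have := NArrow.base r (KTildeArrow.alpha (n := n) (s - 1) h)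
  rw [sub_add_cancel] at this
  exact ⟨⟨this⟩, by simp⟩

lemma upStep_prime {n g : ℕ} (r : ℕ) {s : ℤ} (h : (s - 1) % (n + 1 : ℕ) < (g : ℤ)) :
    UpStep (n := n) (g := g) ⟨r, s - 1⟩ ⟨r + 1, s⟩ := by
  have := NArrow.prime r (KTildeArrow.beta (n := n) (s - 1) h)
  rw [sub_add_cancel] at this
  exact ⟨⟨this⟩, by simp⟩

lemma downStep_base {n g : ℕ} (r : ℕ) {s : ℤ} (h : s % (n + 1 : ℕ) < (g : ℤ)) :
    DownStep (n := n) (g := g) ⟨r, s + 1⟩ ⟨r, s⟩ :=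
  ⟨⟨NArrow.base r (KTildeArrow.beta s h)⟩, by simp⟩

lemma downStep_prime {n g : ℕ} (r : ℕ) {s : ℤ} (h : (g : ℤ) ≤ s % (n + 1 : ℕ)) :
    DownStep (n := n) (g := g) ⟨r, s + 1⟩ ⟨r + 1, s⟩ :=
  ⟨⟨NArrow.prime r (KTildeArrow.alpha s h)⟩, by simp⟩

lemma upStep_floorP {n g : ℕ} (hg : 1 ≤ g) (r : ℕ) (s : ℤ) :
    Relation.ReflTransGen UpStep (⟨r, floorP n g s⟩ : NVertex n g) ⟨r, s⟩ := by
  have key : ∀ (m : ℕ) (s : ℤ), s - floorP n g s = m →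
      Relation.ReflTransGen UpStep (⟨r, floorP n g s⟩ : NVertex n g) ⟨r, s⟩ := by
    intro m
    induction m with
    | zero => intro s h; rw [show floorP n g s = s by omega]
    | succ m ih =>
      intro s h
      have hs : ¬ (s - 1) % (n + 1 : ℕ) < (g : ℤ) := fun h' => by
        have := le_floorP (n := n) le_rfl h'; omega
      have e : floorP n g (s - 1) = floorP n g s :=
        le_antisymm (floorP_mono hg (by omega)) (le_floorP (by omega) (floorP_mod hg s))
      have := ih (s - 1) (by omega)
      rw [e] at this
      exact this.tail (upStep_base r (by omega))
  exact key (s - floorP n g s).toNat s (by have := floorP_le n g s; omega)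

lemma downStep_ceilQ {n g : ℕ} (hgn : g ≤ n) (r : ℕ) (s : ℤ) :
    Relation.ReflTransGen DownStep (⟨r, ceilQ n g s⟩ : NVertex n g) ⟨r, s⟩ := by
  have key : ∀ (m : ℕ) (s : ℤ), ceilQ n g s - s = m →
      Relation.ReflTransGen DownStep (⟨r, ceilQ n g s⟩ : NVertex n g) ⟨r, s⟩ := by
    intro m
    induction m with
    | zero => intro s h; rw [show ceilQ n g s = s by omega]
    | succ m ih =>
      intro s h
      have hs : ¬ (g : ℤ) ≤ s % (n + 1 : ℕ) := fun h' => by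
        have := ceilQ_le (n := n) le_rfl h'; omega
      have e : ceilQ n g (s + 1) = ceilQ n g s :=
        le_antisymm (ceilQ_le (by omega) (ceilQ_mod hgn s)) (ceilQ_mono hgn (by omega))
      have := ih (s + 1) (by omega)
      rw [e] at this
      exact this.tail (downStep_base r (by omega))
  exact key (ceilQ n g s - s).toNat s (by have := le_ceilQ n g s; omega)

/-- The vertex `(0, startP r s)` is the start of a path of arrows `(l, i) → (l', i + 1)` that
ends at `(r, s)`, and this path cannot be prolonged at its start. -/
lemma startP_spec {n g : ℕ} (hg : 1 ≤ g) (r : ℕ) (s : ℤ) :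
    Relation.ReflTransGen UpStep (⟨0, startP n g r s⟩ : NVertex n g) ⟨r, s⟩ ∧
      ∀ X : NVertex n g, ¬ UpStep X ⟨0, startP n g r s⟩ := by
  constructor
  · induction r generalizing s with
    | zero => exact upStep_floorP hg 0 s
    | succ r ih =>
      exact ((ih (floorP n g s - 1)).tail (upStep_prime r (floorP_mod hg s))).trans
        (upStep_floorP hg (r + 1) s)
  · rintro X ⟨⟨γ⟩, h⟩
    have hP := startP_mod (n := n) hg r s
    generalize startP n g r s = t at γ h hP
    change NArrow n g X _ at γ
    cases γ with
    | base r γ =>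
      cases γ with
      | alpha i hi => simp only [add_sub_cancel_right] at hP; omega
      | beta i hi => simp only at h; omega

/-- The vertex `(0, startQ r s)` is the start of a path of arrows `(l, i) → (l', i - 1)` that
ends at `(r, s)`, and this path cannot be prolonged at its start. -/
lemma startQ_spec {n g : ℕ} (hgn : g ≤ n) (r : ℕ) (s : ℤ) :
    Relation.ReflTransGen DownStep (⟨0, startQ n g r s⟩ : NVertex n g) ⟨r, s⟩ ∧
      ∀ X : NVertex n g, ¬ DownStep X ⟨0, startQ n g r s⟩ := by
  constructor
  · induction r generalizing s with
    | zero => exact downStep_ceilQ hgn 0 s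
    | succ r ih =>
      exact ((ih (ceilQ n g s + 1)).tail (downStep_prime r (ceilQ_mod hgn s))).trans
        (downStep_ceilQ hgn (r + 1) s)
  · rintro X ⟨⟨γ⟩, h⟩
    have hQ := startQ_mod hgn r s
    generalize startQ n g r s = t at γ h hQ
    change NArrow n g X _ at γ
    cases γ with
    | base r γ =>
      cases γ with
      | alpha i hi => simp only at h; omega
      | beta i hi => omega

lemma NArrow.startP_le {n g : ℕ} (hg : 1 ≤ g) {X Y : NVertex n g} (γ : NArrow n g X Y) :
    startP n g Y.r Y.s ≤ startP n g X.r X.s := by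
  cases γ with
  | base r γ =>
    cases γ with
    | alpha _ hi =>
      rename_i i
      have e : floorP n g (i + 1) = floorP n g i := by
        refine le_antisymm (le_floorP ?_ (floorP_mod hg _)) (floorP_mono hg (by omega))
        have := floorP_le n g (i + 1)
        have := floorP_mod (n := n) hg (i + 1)
        by_contra h
        rw [show floorP n g (i + 1) = i + 1 by omega, add_sub_cancel_right] at this
        omega
      cases r with
      | zero => simp [startP, e]
      | succ r => simp [startP, e]
    | beta _ hi => exact startP_mono hg r (by simp)
  | prime r γ =>
    cases γ with
    | alpha _ hi =>
      rename_i i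
      exact startP_mono hg r (by have := floorP_le n g i; simp only; omega)
    | beta _ hi =>
      rename_i i
      exact startP_mono hg r (by have := floorP_le n g (i + 1); simp only; omega)

lemma NArrow.le_startQ {n g : ℕ} (hgn : g ≤ n) {X Y : NVertex n g} (γ : NArrow n g X Y) :
    startQ n g X.r X.s ≤ startQ n g Y.r Y.s := by
  cases γ with
  | base r γ =>
    cases γ with
    | alpha _ hi => exact startQ_mono hgn r (by simp)
    | beta _ hi =>
      rename_i i
      have e : ceilQ n g (i + 1) = ceilQ n g i := by
        refine le_antisymm (ceilQ_le ?_ (ceilQ_mod hgn _)) (ceilQ_mono hgn (by omega))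
        have := le_ceilQ n g i
        have := ceilQ_mod hgn i
        by_contra h
        rw [show ceilQ n g i = i by omega] at this
        omega
      cases r with
      | zero => simp [startQ, e]
      | succ r => simp [startQ, e]
  | prime r γ =>
    cases γ with
    | alpha _ hi =>
      rename_i i
      exact startQ_mono hgn r (by have := le_ceilQ n g i; simp only; omega)
    | beta _ hi =>
      rename_i i
      exact startQ_mono hgn r (by have := le_ceilQ n g (i + 1); simp only; omega)

/-! ### The morphisms `e_t ↦ e_t` -/

lemma basisVec_of {k : Type u} [Field k] {n : ℕ} {p q : ℤ} {x : ZMod (n + 1)} {i : ℤ}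
    (h : p ≤ i ∧ i ≤ q ∧ (i : ZMod (n + 1)) = x) :
    basisVec k n p q x i = Finsupp.single ⟨i, h⟩ 1 := dif_pos h

lemma intCast_val (n : ℕ) (i : ℤ) : (((i : ZMod (n + 1)).val : ℕ) : ℤ) = i % (n + 1 : ℕ) :=
  ZMod.val_intCast i

/-- The linear maps `e_i ↦ e_{i+c}`. -/
noncomputable def shiftMap (k : Type u) [Field k] {n : ℕ} (p q p' q' c : ℤ) (x : ZMod (n + 1)) :
    (Slot n p q x →₀ k) →ₗ[k] (Slot n p' q' x →₀ k) :=
  Finsupp.linearCombination k fun i : Slot n p q x => basisVec k n p' q' x (i.1 + c)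

lemma shiftMap_arrowMap (k : Type u) [Field k] {n g : ℕ} {p q p' q' c : ℤ}
    (hc : ((n + 1 : ℕ) : ℤ) ∣ c) (hp : p' ≤ p + c) (hq : q + c ≤ q')
    (hP : (p - 1) % (n + 1 : ℕ) < (g : ℤ)) (hQ : (g : ℤ) ≤ q % (n + 1 : ℕ))
    {x y : ZMod (n + 1)} (γ : KArrow n g x y) :
    shiftMap k p q p' q' c y ∘ₗ arrowMap k p q γ =
      arrowMap k p' q' γ ∘ₗ shiftMap k p q p' q' c x := by
  have hc0 : ((c : ℤ) : ZMod (n + 1)) = 0 := (ZMod.intCast_zmod_eq_zero_iff_dvd c (n + 1)).2 hc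
  refine Finsupp.lhom_ext' fun i => LinearMap.ext_ring ?_
  obtain ⟨i, h1, h2, h3⟩ := i
  cases γ with
  | beta x hx =>
    have hiq : i < q := by
      rcases h2.lt_or_eq with h | rfl
      · exact h
      · have := intCast_val n i
        rw [h3] at this
        omega
    simp only [arrowMap, shiftMap, LinearMap.comp_apply, Finsupp.lsingle_apply,
      Finsupp.linearCombination_single, one_smul]
    rw [if_pos hiq, basisVec_of (i := i + 1) ⟨by omega, by omega, by push_cast; rw [h3]⟩,
      basisVec_of (i := i + c) ⟨by omega, by omega, by push_cast; rw [h3, hc0, add_zero]⟩]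
    simp only [Finsupp.linearCombination_single, one_smul]
    rw [if_pos (by omega), add_right_comm]
  | alpha x hx =>
    have hip : p < i := by
      rcases h1.lt_or_eq with h | rfl
      · exact h
      · have := intCast_val n (p - 1)
        rw [Int.cast_sub, h3, Int.cast_one, add_sub_cancel_right] at this
        omega
    simp only [arrowMap, shiftMap, LinearMap.comp_apply, Finsupp.lsingle_apply,
      Finsupp.linearCombination_single, one_smul]
    rw [if_pos hip, basisVec_of (i := i - 1) ⟨by omega, by omega, by push_cast; rw [h3]; ring⟩,
      basisVec_of (i := i + c) ⟨by omega, by omega, by push_cast; rw [h3, hc0, add_zero]⟩]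
    simp only [Finsupp.linearCombination_single, one_smul]
    rw [if_pos (by omega), sub_add_eq_add_sub]

lemma shiftMap_comp (k : Type u) [Field k] {n : ℕ} {p q p' q' p'' q'' c c' : ℤ}
    (hc : ((n + 1 : ℕ) : ℤ) ∣ c) (hp : p' ≤ p + c) (hq : q + c ≤ q') (x : ZMod (n + 1)) :
    shiftMap k p' q' p'' q'' c' x ∘ₗ shiftMap k p q p' q' c x =
      shiftMap k p q p'' q'' (c + c') x := by
  have hc0 : ((c : ℤ) : ZMod (n + 1)) = 0 := (ZMod.intCast_zmod_eq_zero_iff_dvd c (n + 1)).2 hc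
  refine Finsupp.lhom_ext' fun i => LinearMap.ext_ring ?_
  obtain ⟨i, h1, h2, h3⟩ := i
  simp only [shiftMap, LinearMap.comp_apply, Finsupp.lsingle_apply,
    Finsupp.linearCombination_single, one_smul]
  rw [basisVec_of (i := i + c) ⟨by omega, by omega, by push_cast; rw [h3, hc0, add_zero]⟩]
  simp only [Finsupp.linearCombination_single, one_smul]
  rw [add_assoc]

/-- A family of morphisms that is natural with respect to arrows is natural with respect to
paths. -/
def pathsNatTrans {V C : Type*} [Quiver V] [Category* C] (φ ψ : V ⥤q C)
    (τ : ∀ x, φ.obj x ⟶ ψ.obj x)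
    (hτ : ∀ {x y : V} (γ : x ⟶ y), φ.map γ ≫ τ y = τ x ≫ ψ.map γ) :
    Paths.lift φ ⟶ Paths.lift ψ where
  app x := τ x
  naturality X Y f := by
    refine Paths.induction_fixed_source
      (fun {b} f => (Paths.lift φ).map f ≫ τ b = τ X ≫ (Paths.lift ψ).map f) ?_ ?_ f
    · exact (Category.id_comp _).trans (Category.comp_id _).symm
    · intro u v f γ ih
      have h1 : (Paths.lift φ).map ((Paths.of V).map γ) = φ.map γ := Paths.lift_toPath φ γ
      have h2 : (Paths.lift ψ).map ((Paths.of V).map γ) = ψ.map γ := Paths.lift_toPath ψ γ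
      refine (congrArg (· ≫ τ v) (((Paths.lift φ).map_comp f _).trans (congrArg (_ ≫ ·) h1))).trans ?_
      refine Eq.trans ?_
        (congrArg (τ X ≫ ·) (((Paths.lift ψ).map_comp f _).trans (congrArg (_ ≫ ·) h2))).symm
      refine (Category.assoc _ _ _).trans ((congrArg _ (hτ γ)).trans ?_)
      refine (Category.assoc _ _ _).symm.trans ((congrArg (· ≫ ψ.map γ) ih).trans ?_)
      exact Category.assoc _ _ _

/-- The morphism of representations `e_i ↦ e_{i+c}`. -/
noncomputable def rawIncl (k : Type u) [Field k] {n g : ℕ} {p q p' q' : ℤ} (c : ℤ)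
    (hc : ((n + 1 : ℕ) : ℤ) ∣ c) (hp : p' ≤ p + c) (hq : q + c ≤ q')
    (hP : (p - 1) % (n + 1 : ℕ) < (g : ℤ)) (hQ : (g : ℤ) ≤ q % (n + 1 : ℕ)) :
    rawWalkRep k n g p q ⟶ rawWalkRep k n g p' q' :=
  pathsNatTrans _ _ (fun x => ModuleCat.ofHom (shiftMap k p q p' q' c x)) fun γ =>
    ModuleCat.hom_ext (shiftMap_arrowMap k hc hp hq hP hQ γ)

lemma rawIncl_comp (k : Type u) [Field k] {n g : ℕ} {p q p' q' p'' q'' : ℤ} (c c' : ℤ)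
    (hc : ((n + 1 : ℕ) : ℤ) ∣ c) (hp : p' ≤ p + c) (hq : q + c ≤ q')
    (hP : (p - 1) % (n + 1 : ℕ) < (g : ℤ)) (hQ : (g : ℤ) ≤ q % (n + 1 : ℕ))
    (hc' : ((n + 1 : ℕ) : ℤ) ∣ c') (hp' : p'' ≤ p' + c') (hq' : q' + c' ≤ q'')
    (hP' : (p' - 1) % (n + 1 : ℕ) < (g : ℤ)) (hQ' : (g : ℤ) ≤ q' % (n + 1 : ℕ)) :
    rawIncl k c hc hp hq hP hQ ≫ rawIncl k c' hc' hp' hq' hP' hQ' =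
      rawIncl k (c + c') (dvd_add hc hc') (by omega) (by omega) hP hQ := by
  refine NatTrans.ext (funext fun x => ModuleCat.hom_ext ?_)
  exact shiftMap_comp k hc hp hq x

lemma dvd_emod_sub (n : ℕ) (p : ℤ) : ((n + 1 : ℕ) : ℤ) ∣ p % (n + 1 : ℕ) - p :=
  (Int.mod_modEq p (n + 1 : ℕ)).symm.dvd

lemma dvd_shift (n : ℕ) (p p' : ℤ) :
    ((n + 1 : ℕ) : ℤ) ∣ (p' % (n + 1 : ℕ) - p') - (p % (n + 1 : ℕ) - p) :=
  dvd_sub (dvd_emod_sub n p') (dvd_emod_sub n p)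

/-- For `p' ≤ p ≤ q ≤ q'` with `p ≡ 1, …, g` and `q ≡ g, …, n`, the morphism
`V_(p,q) → V_(p',q')` sending `e_t` to `e_t`, where the `e_t` are those of the walks `(p, q)` and
`(p', q')` themselves. In the bases of the normalised walks this is the morphism `e_t ↦ e_{t+c}`,
where `c` is the difference of the two normalisation shifts: `c = 0` if `p` and `p'` lie in the
same block of length `n + 1`, and `c = n + 1` if `p'` lies in the block just below that
of `p`. -/
noncomputable def walkIncl (k : Type u) [Field k] {n g : ℕ} {p q p' q' : ℤ}
    (hp : p' ≤ p) (hq : q ≤ q')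
    (hP : (p - 1) % (n + 1 : ℕ) < (g : ℤ)) (hQ : (g : ℤ) ≤ q % (n + 1 : ℕ)) :
    walkRep k n g p q ⟶ walkRep k n g p' q' :=
  rawIncl k ((p' % (n + 1 : ℕ) - p') - (p % (n + 1 : ℕ) - p)) (dvd_shift n p p')
    (by omega) (by omega)
    (by rwa [Int.emod_sub_emod])
    (by
      obtain ⟨d, hd⟩ := dvd_emod_sub n p
      rwa [add_sub_assoc, hd, Int.add_mul_emod_self_left])

lemma walkIncl_comp (k : Type u) [Field k] {n g : ℕ} {p q p' q' p'' q'' : ℤ}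
    (hp : p' ≤ p) (hq : q ≤ q')
    (hP : (p - 1) % (n + 1 : ℕ) < (g : ℤ)) (hQ : (g : ℤ) ≤ q % (n + 1 : ℕ))
    (hp' : p'' ≤ p') (hq' : q' ≤ q'')
    (hP' : (p' - 1) % (n + 1 : ℕ) < (g : ℤ)) (hQ' : (g : ℤ) ≤ q' % (n + 1 : ℕ)) :
    walkIncl k hp hq hP hQ ≫ walkIncl k hp' hq' hP' hQ' =
      walkIncl k (hp'.trans hp) (hq.trans hq') hP hQ := by
  unfold walkIncl
  refine (rawIncl_comp k _ _ _ _ _ _ _ _ _ _ _ _).trans ?_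
  congr 1
  ring

/-! ### The functors `F` and `F̄` -/

/-- The linear maps on morphism spaces of `freeLift`. -/
noncomputable def freeLiftMap (k : Type*) [CommRing k] {C D : Type*} [Category* C] [Category* D]
    [Preadditive D] [Linear k D] (F : C ⥤ D) (X Y : C) :
    (Free.of k X ⟶ Free.of k Y) →ₗ[k] (F.obj X ⟶ F.obj Y) :=
  Finsupp.linearCombination k (fun f : X ⟶ Y => F.map f)

lemma freeLiftMap_single (k : Type*) [CommRing k] {C D : Type*} [Category* C] [Category* D]
    [Preadditive D] [Linear k D] (F : C ⥤ D) {X Y : C} (f : X ⟶ Y) (t : k) :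
    freeLiftMap k F X Y (Finsupp.single f t) = t • F.map f :=
  Finsupp.linearCombination_single k _ _

lemma freeLiftMap_comp (k : Type*) [CommRing k] {C D : Type*} [Category* C] [Category* D]
    [Preadditive D] [Linear k D] (F : C ⥤ D) {X Y Z : C} (f : Free.of k X ⟶ Free.of k Y)
    (f' : Free.of k Y ⟶ Free.of k Z) :
    freeLiftMap k F X Z (f ≫ f') = freeLiftMap k F X Y f ≫ freeLiftMap k F Y Z f' := by
  refine Finsupp.induction_linear f ?_ (fun a b ha hb => ?_) (fun a t => ?_)
  · refine (congrArg _ Limits.zero_comp).trans ((map_zero _).trans ?_)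
    exact (Limits.zero_comp.symm.trans (congrArg (· ≫ _) (map_zero _).symm))
  · refine (congrArg _ (Preadditive.add_comp _ _ _ _ _ _)).trans ((map_add _ _ _).trans ?_)
    rw [ha, hb]
    exact ((Preadditive.add_comp _ _ _ _ _ _).symm.trans
      (congrArg (· ≫ _) (map_add (freeLiftMap k F X Y) a b).symm))
  · refine Finsupp.induction_linear f' ?_ (fun c d hc hd => ?_) (fun c t' => ?_)
    · refine (congrArg _ Limits.comp_zero).trans ((map_zero _).trans ?_)
      exact (Limits.comp_zero.symm.trans (congrArg (_ ≫ ·) (map_zero _).symm))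
    · refine (congrArg _ (Preadditive.comp_add _ _ _ _ _ _)).trans ((map_add _ _ _).trans ?_)
      rw [hc, hd]
      exact ((Preadditive.comp_add _ _ _ _ _ _).symm.trans
        (congrArg (_ ≫ ·) (map_add (freeLiftMap k F Y Z) c d).symm))
    · refine (congrArg _ (Free.single_comp_single k C a c t t')).trans ?_
      have e : (t * t') • F.map ((show X ⟶ Y from a) ≫ (show Y ⟶ Z from c)) =
          (t • F.map (show X ⟶ Y from a)) ≫ (t' • F.map (show Y ⟶ Z from c)) := by
        rw [F.map_comp, Linear.smul_comp, Linear.comp_smul, smul_smul]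
      exact (freeLiftMap_single k F _ _).trans (e.trans
        (congrArg₂ (· ≫ ·) (freeLiftMap_single k F _ _) (freeLiftMap_single k F _ _)).symm)

/-- The `k`-linear functor on the free `k`-linear category on `C` that extends a functor on
`C`. -/
noncomputable def freeLift (k : Type*) [CommRing k] {C D : Type*} [Category* C] [Category* D]
    [Preadditive D] [Linear k D] (F : C ⥤ D) : Free k C ⥤ D where
  obj X := F.obj X
  map {X Y} f := freeLiftMap k F X Y f
  map_id X := by
    refine (freeLiftMap_single k F (𝟙 (show C from X)) 1).trans ?_
    rw [one_smul]
    exact F.map_id X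
  map_comp f f' := freeLiftMap_comp k F f f'

instance (k : Type*) [CommRing k] {C D : Type*} [Category* C] [Category* D]
    [Preadditive D] [Linear k D] (F : C ⥤ D) : (freeLift k F).Additive where
  map_add := map_add (freeLiftMap k F _ _) _ _

instance (k : Type*) [CommRing k] {C D : Type*} [Category* C] [Category* D]
    [Preadditive D] [Linear k D] (F : C ⥤ D) : (freeLift k F).Linear k where
  map_smul f t := map_smul (freeLiftMap k F _ _) t f

/-- `F(r, s) = V_(p,q)`, where `(0, p)` and `(0, q)` are the starting points of the two maximal
paths that end at `(r, s)`. -/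
noncomputable def objF (k : Type u) [Field k] {n g : ℕ} (hg : 1 ≤ g) (hgn : g ≤ n)
    (X : NVertex n g) : PostProj k n g :=
  postProj k n g (startP n g X.r X.s) (startQ n g X.r X.s)
    (isPostProjectiveWalk_start hg hgn X.r X.s)

/-- For an arrow `γ : X → Y` of `ℕK̃`, the morphism `F γ : F X → F Y` is `e_t ↦ e_t`. -/
noncomputable def mapF (k : Type u) [Field k] {n g : ℕ} (hg : 1 ≤ g) (hgn : g ≤ n)
    {X Y : NVertex n g} (γ : X ⟶ Y) : objF k hg hgn X ⟶ objF k hg hgn Y :=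
  ObjectProperty.homMk (walkIncl k (NArrow.startP_le hg γ) (NArrow.le_startQ hgn γ)
    (startP_mod hg X.r X.s) (startQ_mod hgn X.r X.s))

lemma mapF_comp (k : Type u) [Field k] {n g : ℕ} (hg : 1 ≤ g) (hgn : g ≤ n)
    {X Y Z : NVertex n g} (γ : X ⟶ Y) (γ' : Y ⟶ Z) :
    mapF k hg hgn γ ≫ mapF k hg hgn γ' = ObjectProperty.homMk (walkIncl k
      ((NArrow.startP_le hg γ').trans (NArrow.startP_le hg γ))
      ((NArrow.le_startQ hgn γ).trans (NArrow.le_startQ hgn γ'))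
      (startP_mod hg X.r X.s) (startQ_mod hgn X.r X.s)) :=
  ObjectProperty.hom_ext _ (walkIncl_comp k (NArrow.startP_le hg γ) (NArrow.le_startQ hgn γ)
    (startP_mod hg X.r X.s) (startQ_mod hgn X.r X.s) (NArrow.startP_le hg γ')
    (NArrow.le_startQ hgn γ') (startP_mod hg Y.r Y.s) (startQ_mod hgn Y.r Y.s))

/-- The functor `F : kℕK̃ → P`. -/
noncomputable def functorF (k : Type u) [Field k] {n g : ℕ} (hg : 1 ≤ g) (hgn : g ≤ n) :
    PathAlg k n g ⥤ PostProj k n g :=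
  freeLift k (Paths.lift { obj := objF k hg hgn, map := fun γ => mapF k hg hgn γ })

noncomputable instance (k : Type u) [Field k] {n g : ℕ} (hg : 1 ≤ g) (hgn : g ≤ n) :
    (functorF k hg hgn).Additive :=
  inferInstanceAs (freeLift k _).Additive

noncomputable instance (k : Type u) [Field k] {n g : ℕ} (hg : 1 ≤ g) (hgn : g ≤ n) :
    (functorF k hg hgn).Linear k :=
  inferInstanceAs ((freeLift k _).Linear k)

lemma functorF_pathTwo (k : Type u) [Field k] {n g : ℕ} (hg : 1 ≤ g) (hgn : g ≤ n)
    {X Y Z : NVertex n g} (γ : X ⟶ Y) (γ' : Y ⟶ Z) :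
    (functorF k hg hgn).map (pathTwo k γ γ') = mapF k hg hgn γ ≫ mapF k hg hgn γ' := by
  refine (freeLiftMap_single k _ _ 1).trans ?_
  rw [one_smul]
  refine ((Paths.lift _).map_comp _ _).trans ?_
  exact congrArg₂ (· ≫ ·) (Paths.lift_toPath _ γ) (Paths.lift_toPath _ γ')

/-- `J` is annihilated by `F`. -/
lemma functorF_map_eq_zero (k : Type u) [Field k] {n g : ℕ} (hg : 1 ≤ g) (hgn : g ≤ n)
    {X Y : PathAlg k n g} {f : X ⟶ Y} (hf : f ∈ meshIdeal k n g X Y) :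
    (functorF k hg hgn).map f = 0 := by
  induction hf using Submodule.span_induction with
  | mem f hf =>
    obtain ⟨A, B, a, m, b, hm, rfl⟩ := hf
    have : (functorF k hg hgn).map m = 0 := by
      cases hm with
      | mk hY γ γ' δ δ' =>
        refine (Functor.map_sub _).trans (sub_eq_zero.2 ?_)
        refine (functorF_pathTwo k hg hgn γ γ').trans (Eq.trans ?_
          (functorF_pathTwo k hg hgn δ δ').symm)
        exact (mapF_comp k hg hgn γ γ').trans (mapF_comp k hg hgn δ δ').symm
    rw [Functor.map_comp, Functor.map_comp, this, Limits.zero_comp, Limits.comp_zero]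
  | zero => exact Functor.map_zero _ _ _
  | add f f' _ _ h h' => rw [Functor.map_add, h, h', add_zero]
  | smul t f _ h => rw [Functor.map_smul, h, smul_zero]

/-- The functor `F̄ : k(ℕK̃) → P` induced by `F`. -/
noncomputable def functorFBar (k : Type u) [Field k] {n g : ℕ} (hg : 1 ≤ g) (hgn : g ≤ n) :
    MeshCat k n g ⥤ PostProj k n g :=
  CategoryTheory.Quotient.lift (meshRel k n g) (functorF k hg hgn) fun X Y f f' h => by
    have := functorF_map_eq_zero k hg hgn h
    rwa [Functor.map_sub, sub_eq_zero] at this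

instance (k : Type u) [Field k] {n g : ℕ} (hg : 1 ≤ g) (hgn : g ≤ n) :
    (functorFBar k hg hgn).Additive where
  map_add {X Y f f'} := by
    obtain ⟨f, rfl⟩ := (CategoryTheory.Quotient.functor _).map_surjective f
    obtain ⟨f', rfl⟩ := (CategoryTheory.Quotient.functor _).map_surjective f'
    exact (functorF k hg hgn).map_add

instance (k : Type u) [Field k] {n g : ℕ} (hg : 1 ≤ g) (hgn : g ≤ n) :
    (functorFBar k hg hgn).Linear k where
  map_smul {X Y} f t := by
    obtain ⟨f, rfl⟩ := (CategoryTheory.Quotient.functor _).map_surjective f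
    have e := (CategoryTheory.Quotient.functor (meshRel k n g)).map_smul t f
    exact (congrArg (functorFBar k hg hgn).map e.symm).trans ((functorF k hg hgn).map_smul t f)

open scoped DirectSum

/-- For objects `V` of `P` and `Y` of `k(ℕK̃)`, the `k`-linear map from the direct sum of the
spaces `Hom(X, Y)` over all vertices `X` with `F̄ X = V` to `Hom(V, F̄ Y)` that sends a family
`(μ_X)` to `∑ F̄ μ_X`. -/
noncomputable def fibreMap (k : Type u) [Field k] {n g : ℕ} (hg : 1 ≤ g) (hgn : g ≤ n)
    (V : PostProj k n g) (Y : MeshCat k n g) :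
    (⨁ X : {X : MeshCat k n g // (functorFBar k hg hgn).obj X = V}, (X.1 ⟶ Y)) →ₗ[k]
      (V ⟶ (functorFBar k hg hgn).obj Y) :=
  open Classical in
  DirectSum.toModule k _ _ fun X =>
    Linear.leftComp k ((functorFBar k hg hgn).obj Y) (eqToHom X.2.symm) ∘ₗ
      (functorFBar k hg hgn).mapLinearMap k

/-- On the summand of `X`, the map is `μ ↦ F̄ μ`, read as a morphism with source `V = F̄ X`. -/
lemma fibreMap_lof (k : Type u) [Field k] {n g : ℕ} (hg : 1 ≤ g) (hgn : g ≤ n)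
    (V : PostProj k n g) (Y : MeshCat k n g)
    [DecidableEq {X : MeshCat k n g // (functorFBar k hg hgn).obj X = V}]
    (X : {X : MeshCat k n g // (functorFBar k hg hgn).obj X = V}) (μ : X.1 ⟶ Y) :
    fibreMap k hg hgn V Y (DirectSum.lof k _ (fun X : {X : MeshCat k n g //
      (functorFBar k hg hgn).obj X = V} => (X.1 ⟶ Y)) X μ) =
      eqToHom X.2.symm ≫ (functorFBar k hg hgn).map μ := by
  unfold fibreMap
  convert DirectSum.toModule_lof k (M := fun X : {X : MeshCat k n g //
    (functorFBar k hg hgn).obj X = V} => (X.1 ⟶ Y)) X μ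
  rfl

end AffineA

namespace AffineA

/-! ### Coordinates on the vertices of `ℕK̃` -/

/-! Both sides have explicit bases, and the map matches them.

Source. Number the integers `q ≡ g, …, n` and the integers `p ≡ 1, …, g` in increasing order. A
vertex `(r, s)` is determined by the numbers `indexQ` and `indexP` of its two starting points, whose
sum is `s`. Every arrow raises `indexQ` by one or lowers `indexP` by one, so `ℕK̃` is the part `p ≤
q` of a square grid, and `J` makes its squares commute. Hence parallel paths agree modulo `J`
(`pathClass_eq`), and `Hom(X, Y)` is spanned by the class of a single path if the walk of `X` lies
inside the walk of `Y`, and is zero otherwise.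

Target. For post-projective walks no `β` kills `e_q` and no `α` kills `e_p`, so the matrix of a
morphism `V_(p,q) → V_(p',q')` is constant along diagonals (`entry_eq`). The morphisms are therefore
the combinations of the shifts `e_i ↦ e_{i+d}` with `n + 1 ∣ d`, `p' ≤ p + d` and `q + d ≤ q'`
(`shiftCoeff_eq_zero`, `eq_zero_of_shiftCoeff`).

Matching. `F̄` sends the class of a path to a shift (`functorFBar_pathClass`). The vertices over
`V_(p,q)` are those with walk `(p + c, q + c)`, `n + 1 ∣ c`; for fixed `Y` distinct ones give
distinct shifts (`eq_of_shiftOf_eq`), and every admissible shift occurs (`exists_path_shiftOf`). The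
linear forms `homCoeff` read off the coefficients. They also show that path classes are nonzero, so
`J` needs no separate lower bound. -/

/-- The signed number of integers `q ≡ g, …, n` between `0` and `s`. -/
def countQ (n g : ℕ) (s : ℤ) : ℤ :=
  (n + 1 - g : ℤ) * (s / (n + 1 : ℕ)) + max 0 (s % (n + 1 : ℕ) - g)

/-- The interval counted is half open, so the step from `s` to `s + 1` registers `s` itself. Dually,
`s - countQ n g s` grows in the step from `p - 1` to `p` exactly when `p ≡ 1, …, g`, and so numbers
these integers. -/
lemma countQ_succ_of_le {n g : ℕ} {s : ℤ} (h : (g : ℤ) ≤ s % (n + 1 : ℕ)) :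
    countQ n g (s + 1) = countQ n g s + 1 := by
  obtain ⟨h2, h3⟩ := (mod_add_mul_div n s).choose_spec.2
  have h1 := (Int.mul_ediv_add_emod s (n + 1 : ℕ)).symm
  have hpos : (0 : ℤ) < (n + 1 : ℕ) := by positivity
  unfold countQ
  rcases (Int.add_one_le_iff.2 h3).lt_or_eq with h4 | h4
  · have e := (Int.ediv_emod_unique hpos (r := s % (n + 1 : ℕ) + 1) (q := s / (n + 1 : ℕ))
      (a := s + 1)).2 ⟨by omega, by omega, by omega⟩
    rw [e.1, e.2, max_eq_right (by omega), max_eq_right (by omega)]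
    ring
  -- The residue is `n`, so `s + 1` opens a new block: the first term gains `n + 1 - g` while the
  -- second drops from `n - g` to `0`.
  · have e := (Int.ediv_emod_unique hpos (r := 0) (q := s / (n + 1 : ℕ) + 1)
      (a := s + 1)).2 ⟨by rw [mul_add]; omega, by omega, by omega⟩
    rw [e.1, e.2, max_eq_left (by omega), max_eq_right (by omega)]
    push_cast at h4 ⊢
    linarith

lemma countQ_succ_of_lt {n g : ℕ} (hgn : g ≤ n) {s : ℤ} (h : s % (n + 1 : ℕ) < (g : ℤ)) :
    countQ n g (s + 1) = countQ n g s := by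
  obtain ⟨h2, h3⟩ := (mod_add_mul_div n s).choose_spec.2
  have h1 := (Int.mul_ediv_add_emod s (n + 1 : ℕ)).symm
  have hpos : (0 : ℤ) < (n + 1 : ℕ) := by positivity
  unfold countQ
  -- No carry occurs, since the new residue is at most `g ≤ n`.
  have e := (Int.ediv_emod_unique hpos (r := s % (n + 1 : ℕ) + 1) (q := s / (n + 1 : ℕ))
    (a := s + 1)).2 ⟨by omega, by omega, by omega⟩
  rw [e.1, e.2, max_eq_left (by omega), max_eq_left (by omega)]

lemma countQ_succ_cases {n g : ℕ} (hgn : g ≤ n) (s : ℤ) :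
    ((g : ℤ) ≤ s % (n + 1 : ℕ) ∧ countQ n g (s + 1) = countQ n g s + 1) ∨
      (s % (n + 1 : ℕ) < (g : ℤ) ∧ countQ n g (s + 1) = countQ n g s) := by
  rcases le_or_gt (g : ℤ) (s % (n + 1 : ℕ)) with h | h
  · exact Or.inl ⟨h, countQ_succ_of_le h⟩
  · exact Or.inr ⟨h, countQ_succ_of_lt hgn h⟩

lemma countQ_mono {n g : ℕ} (hgn : g ≤ n) : Monotone (countQ n g) :=
  monotone_int_of_le_succ fun s => by rcases countQ_succ_cases hgn s with h | h <;> omega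

lemma sub_countQ_mono {n g : ℕ} (hgn : g ≤ n) : Monotone fun s => s - countQ n g s :=
  monotone_int_of_le_succ fun s => by rcases countQ_succ_cases hgn s with h | h <;> omega

/-- The count jumps immediately after `q'`, so every integer beyond `q'` has a strictly larger
count; only `q'` needs the residue condition. -/
lemma countQ_le_iff {n g : ℕ} (hgn : g ≤ n) {q q' : ℤ} (h' : (g : ℤ) ≤ q' % (n + 1 : ℕ)) :
    countQ n g q ≤ countQ n g q' ↔ q ≤ q' := by
  refine ⟨fun h => ?_, fun h => countQ_mono hgn h⟩
  by_contra hlt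
  have h1 := countQ_mono hgn (show q' + 1 ≤ q by omega)
  rw [countQ_succ_of_le h'] at h1
  omega

lemma sub_countQ_le_iff {n g : ℕ} (hgn : g ≤ n) {p p' : ℤ}
    (h : (p - 1) % (n + 1 : ℕ) < (g : ℤ)) :
    p - countQ n g p ≤ p' - countQ n g p' ↔ p ≤ p' := by
  refine ⟨fun h' => ?_, fun h' => sub_countQ_mono hgn h'⟩
  by_contra hlt
  have h1 := sub_countQ_mono hgn (show p' ≤ p - 1 by omega)
  have h2 := countQ_succ_of_lt hgn h
  rw [sub_add_cancel] at h2
  simp only at h1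
  omega

/-- No integer `t ≡ g, …, n` satisfies `s ≤ t < ceilQ n g s`, by minimality of `ceilQ`. -/
lemma countQ_ceilQ {n g : ℕ} (hgn : g ≤ n) (s : ℤ) : countQ n g (ceilQ n g s) = countQ n g s := by
  refine le_antisymm ?_ (countQ_mono hgn (le_ceilQ n g s))
  by_contra hlt
  have key : ∀ m : ℕ, s + m ≤ ceilQ n g s → countQ n g (s + m) = countQ n g s := by
    intro m
    induction m with
    | zero => simp
    | succ m ih =>
      intro h
      push_cast at h ⊢
      rw [← ih (by omega), ← add_assoc]
      refine countQ_succ_of_lt hgn (not_le.1 fun h' => ?_)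
      have := ceilQ_le (n := n) (g := g) (s := s) (by omega) h'
      omega
  have := key (ceilQ n g s - s).toNat (by have := le_ceilQ n g s; omega)
  rw [show s + ((ceilQ n g s - s).toNat : ℤ) = ceilQ n g s by
    have := le_ceilQ n g s; omega] at this
  omega

/-- Every `t` with `floorP n g s ≤ t < s` is counted: otherwise `t + 1` would be a larger candidate
for `floorP n g s`. -/
lemma sub_countQ_floorP (n g : ℕ) (s : ℤ) :
    floorP n g s - countQ n g (floorP n g s) = s - countQ n g s := by
  have key : ∀ m : ℕ, floorP n g s + m ≤ s →
      countQ n g (floorP n g s + m) = countQ n g (floorP n g s) + m := by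
    intro m
    induction m with
    | zero => simp
    | succ m ih =>
      intro h
      push_cast at h ⊢
      rw [← add_assoc, ← add_assoc, ← ih (by omega)]
      refine countQ_succ_of_le (not_lt.1 fun h' => ?_)
      have := le_floorP (n := n) (g := g) (s := s) (t := floorP n g s + m + 1) (by omega)
        (by rwa [add_sub_cancel_right])
      omega
  have := key (s - floorP n g s).toNat (by have := floorP_le n g s; omega)
  rw [show floorP n g s + ((s - floorP n g s).toNat : ℤ) = s by
    have := floorP_le n g s; omega] at this
  have := floorP_le n g s
  omega

/-- Each level contributes one: the path passes from `ceilQ n g s` to its successor, and `ceilQ n g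
s` is itself counted. -/
lemma countQ_startQ {n g : ℕ} (hgn : g ≤ n) (r : ℕ) (s : ℤ) :
    countQ n g (startQ n g r s) = countQ n g s + r := by
  induction r generalizing s with
  | zero => simpa [startQ] using countQ_ceilQ hgn s
  | succ r ih =>
    simp only [startQ]
    rw [ih, countQ_succ_of_le (ceilQ_mod hgn s), countQ_ceilQ hgn]
    push_cast
    ring

lemma sub_countQ_startP {n g : ℕ} (hg : 1 ≤ g) (hgn : g ≤ n) (r : ℕ) (s : ℤ) :
    startP n g r s - countQ n g (startP n g r s) = s - countQ n g s - r := by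
  induction r generalizing s with
  | zero => simpa [startP] using sub_countQ_floorP n g s
  | succ r ih =>
    have h1 := countQ_succ_of_lt hgn (floorP_mod (n := n) hg s)
    have h2 := sub_countQ_floorP n g s
    simp only [startP]
    rw [ih]
    rw [sub_add_cancel] at h1
    push_cast
    omega

/-- The index of `startQ r s` among the integers `q ≡ g, …, n`. -/
def NVertex.indexQ {n g : ℕ} (X : NVertex n g) : ℤ := countQ n g X.s + X.r

/-- The index of `startP r s` among the integers `p ≡ 1, …, g`. -/
def NVertex.indexP {n g : ℕ} (X : NVertex n g) : ℤ := X.s - countQ n g X.s - X.r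

lemma NVertex.ext_index {n g : ℕ} {X Y : NVertex n g} (hQ : X.indexQ = Y.indexQ)
    (hP : X.indexP = Y.indexP) : X = Y := by
  unfold indexQ at hQ
  unfold indexP at hP
  have hs : X.s = Y.s := by omega
  rw [hs] at hQ
  exact NVertex.ext (by omega) hs

lemma startQ_le_startQ_iff {n g : ℕ} (hgn : g ≤ n) (X Y : NVertex n g) :
    startQ n g X.r X.s ≤ startQ n g Y.r Y.s ↔ X.indexQ ≤ Y.indexQ := by
  rw [← countQ_le_iff hgn (startQ_mod hgn _ _), countQ_startQ hgn, countQ_startQ hgn]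
  rfl

lemma startP_le_startP_iff {n g : ℕ} (hg : 1 ≤ g) (hgn : g ≤ n) (X Y : NVertex n g) :
    startP n g X.r X.s ≤ startP n g Y.r Y.s ↔ X.indexP ≤ Y.indexP := by
  rw [← sub_countQ_le_iff hgn (startP_mod hg _ _), sub_countQ_startP hg hgn,
    sub_countQ_startP hg hgn]
  rfl

lemma NVertex.ext_start {n g : ℕ} (hg : 1 ≤ g) (hgn : g ≤ n) {X Y : NVertex n g}
    (hP : startP n g X.r X.s = startP n g Y.r Y.s)
    (hQ : startQ n g X.r X.s = startQ n g Y.r Y.s) : X = Y :=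
  NVertex.ext_index
    (le_antisymm ((startQ_le_startQ_iff hgn X Y).1 hQ.le) ((startQ_le_startQ_iff hgn Y X).1 hQ.ge))
    (le_antisymm ((startP_le_startP_iff hg hgn X Y).1 hP.le)
      ((startP_le_startP_iff hg hgn Y X).1 hP.ge))

lemma exists_vertex {n g : ℕ} (hg : 1 ≤ g) (hgn : g ≤ n) {p q : ℤ} (hpq : p ≤ q)
    (hP : (p - 1) % (n + 1 : ℕ) < (g : ℤ)) (hQ : (g : ℤ) ≤ q % (n + 1 : ℕ)) :
    ∃ X : NVertex n g, startP n g X.r X.s = p ∧ startQ n g X.r X.s = q := by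
  have h1 : p - countQ n g p ≤ q - countQ n g q := sub_countQ_mono hgn hpq
  -- The sum of the two indices forces `s`. The hypothesis `p ≤ q` gives `s ≤ q`, which makes the
  -- level `r = countQ n g q - countQ n g s` nonnegative.
  obtain ⟨s, hs⟩ : ∃ s, s = countQ n g q + (p - countQ n g p) := ⟨_, rfl⟩
  have h2 : countQ n g s ≤ countQ n g q := countQ_mono hgn (by omega)
  obtain ⟨r, hr⟩ := Int.eq_ofNat_of_zero_le (sub_nonneg.2 h2)
  refine ⟨⟨r, s⟩, ?_, ?_⟩ <;> dsimp only
  · have h3 := sub_countQ_startP hg hgn r s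
    exact le_antisymm ((sub_countQ_le_iff hgn (startP_mod hg r s)).1 (by omega))
      ((sub_countQ_le_iff hgn hP).1 (by omega))
  · have h3 := countQ_startQ hgn r s
    exact le_antisymm ((countQ_le_iff hgn hQ).1 (by omega))
      ((countQ_le_iff hgn (startQ_mod hgn r s)).1 (by omega))

/-! ### Arrows and paths of `ℕK̃` -/

/-- Both endpoints stay variables and the casts carry the equations, so that two parallel arrows can
be compared. -/
lemma KTildeArrow.eq_cases {n g : ℕ} {i j : ℤ} (γ : KTildeArrow n g i j) :
    (∃ (h : j = i + 1) (hi : (g : ℤ) ≤ i % (n + 1 : ℕ)), γ = h ▸ KTildeArrow.alpha i hi) ∨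
      (∃ (h : i = j + 1) (hj : j % (n + 1 : ℕ) < (g : ℤ)), γ = h ▸ KTildeArrow.beta j hj) := by
  cases γ with
  | alpha _ hi => exact Or.inl ⟨rfl, hi, rfl⟩
  | beta _ hi => exact Or.inr ⟨rfl, hi, rfl⟩

instance (n g : ℕ) (i j : ℤ) : Subsingleton (KTildeArrow n g i j) where
  allEq γ δ := by
    rcases γ.eq_cases with ⟨h, hi, rfl⟩ | ⟨h, hi, rfl⟩ <;>
      rcases δ.eq_cases with ⟨h', hi', rfl⟩ | ⟨h', hi', rfl⟩
    · rfl
    · omega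
    · omega
    · rfl

instance (n g : ℕ) (X Y : NVertex n g) : Subsingleton (X ⟶ Y) where
  allEq γ δ := by
    change NArrow n g X Y at γ δ
    cases γ with
    | base r γ =>
      cases δ with
      | base _ δ => rw [Subsingleton.elim γ δ]
    | prime r γ =>
      cases δ with
      | prime _ δ => rw [Subsingleton.elim γ δ]

/-- Arrows `s → s + 1` raise `indexQ` and arrows `s → s - 1` lower `indexP`; the level `r`
compensates for the behaviour of `countQ`. -/
lemma NArrow.index_cases {n g : ℕ} (hgn : g ≤ n) {X Y : NVertex n g} (γ : X ⟶ Y) :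
    (Y.indexQ = X.indexQ + 1 ∧ Y.indexP = X.indexP) ∨
      (Y.indexQ = X.indexQ ∧ Y.indexP = X.indexP - 1) := by
  change NArrow n g X Y at γ
  unfold NVertex.indexQ NVertex.indexP
  cases γ with
  | base r γ =>
    cases γ with
    | alpha _ hi => have := countQ_succ_of_le hi; dsimp only; omega
    | beta _ hi => have := countQ_succ_of_lt hgn hi; dsimp only; omega
  | prime r γ =>
    cases γ with
    | alpha _ hi => have := countQ_succ_of_le hi; dsimp only; omega
    | beta _ hi => have := countQ_succ_of_lt hgn hi; dsimp only; omega

lemma exists_arrow_indexQ {n g : ℕ} (hgn : g ≤ n) (X : NVertex n g) :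
    ∃ Y : NVertex n g, Nonempty (X ⟶ Y) ∧ Y.indexQ = X.indexQ + 1 ∧ Y.indexP = X.indexP := by
  obtain ⟨r, s⟩ := X
  unfold NVertex.indexQ NVertex.indexP
  rcases countQ_succ_cases hgn s with ⟨h, h'⟩ | ⟨h, h'⟩
  · exact ⟨⟨r, s + 1⟩, ⟨NArrow.base r (KTildeArrow.alpha s h)⟩, by dsimp only; omega,
      by dsimp only; omega⟩
  · exact ⟨⟨r + 1, s + 1⟩, ⟨NArrow.prime r (KTildeArrow.beta s h)⟩, by dsimp only; omega,
      by dsimp only; omega⟩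

lemma exists_arrow_indexP {n g : ℕ} (hgn : g ≤ n) (X : NVertex n g) :
    ∃ Y : NVertex n g, Nonempty (X ⟶ Y) ∧ Y.indexQ = X.indexQ ∧ Y.indexP = X.indexP - 1 := by
  obtain ⟨r, s⟩ := X
  obtain ⟨s, rfl⟩ : ∃ t, s = t + 1 := ⟨s - 1, by omega⟩
  unfold NVertex.indexQ NVertex.indexP
  rcases countQ_succ_cases hgn s with ⟨h, h'⟩ | ⟨h, h'⟩
  · exact ⟨⟨r + 1, s⟩, ⟨NArrow.prime r (KTildeArrow.alpha s h)⟩, by dsimp only; omega,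
      by dsimp only; omega⟩
  · exact ⟨⟨r, s⟩, ⟨NArrow.base r (KTildeArrow.beta s h)⟩, by dsimp only; omega,
      by dsimp only; omega⟩

/-- Arrows of both directions leave every vertex, so one can first raise `indexQ` to its final value
and then lower `indexP`. The induction is on the grid distance. -/
lemma exists_path {n g : ℕ} (hgn : g ≤ n) {X Y : NVertex n g} (hQ : X.indexQ ≤ Y.indexQ)
    (hP : Y.indexP ≤ X.indexP) : Nonempty (Quiver.Path X Y) := by
  obtain ⟨m, hm⟩ := Int.eq_ofNat_of_zero_le
    (show 0 ≤ (Y.indexQ - X.indexQ) + (X.indexP - Y.indexP) by omega)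
  induction m generalizing X with
  | zero => rw [NVertex.ext_index (X := X) (Y := Y) (by omega) (by omega)]; exact ⟨.nil⟩
  | succ m ih =>
    rcases hQ.lt_or_eq with h | h
    · obtain ⟨Z, ⟨γ⟩, h1, h2⟩ := exists_arrow_indexQ hgn X
      obtain ⟨f⟩ := ih (X := Z) (by omega) (by omega) (by push_cast at hm; omega)
      exact ⟨γ.toPath.comp f⟩
    · obtain ⟨Z, ⟨γ⟩, h1, h2⟩ := exists_arrow_indexP hgn X
      obtain ⟨f⟩ := ih (X := Z) (by omega) (by push_cast at hm; omega) (by push_cast at hm; omega)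
      exact ⟨γ.toPath.comp f⟩

lemma index_le_of_path {n g : ℕ} (hgn : g ≤ n) {X Y : NVertex n g} (f : Quiver.Path X Y) :
    X.indexQ ≤ Y.indexQ ∧ Y.indexP ≤ X.indexP ∧
      (f.length : ℤ) = (Y.indexQ - X.indexQ) + (X.indexP - Y.indexP) := by
  induction f with
  | nil => simp
  | cons f γ ih =>
    have := NArrow.index_cases hgn γ
    rw [Quiver.Path.length_cons]
    push_cast
    omega

/-- The vertex whose indices are given, when it can be reached from some other vertex. -/
lemma exists_vertex_index {n g : ℕ} (hgn : g ≤ n) (X : NVertex n g) {j i : ℤ}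
    (hQ : X.indexQ ≤ j) (hP : i ≤ X.indexP) :
    ∃ W : NVertex n g, W.indexQ = j ∧ W.indexP = i := by
  obtain ⟨a, rfl⟩ := Int.le.dest hQ
  obtain ⟨b, rfl⟩ : ∃ b : ℕ, i = X.indexP - b := ⟨(X.indexP - i).toNat, by omega⟩
  clear hQ hP
  induction a with
  | zero =>
    induction b with
    | zero => exact ⟨X, by simp, by simp⟩
    | succ b ih =>
      obtain ⟨W, h1, h2⟩ := ih
      obtain ⟨Z, -, h3, h4⟩ := exists_arrow_indexP hgn W
      exact ⟨Z, by omega, by push_cast; omega⟩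
  | succ a ih =>
    obtain ⟨W, h1, h2⟩ := ih
    obtain ⟨Z, -, h3, h4⟩ := exists_arrow_indexQ hgn W
    exact ⟨Z, by push_cast; omega, by omega⟩

lemma exists_arrow_of_index {n g : ℕ} (hgn : g ≤ n) {X Y : NVertex n g}
    (h : (Y.indexQ = X.indexQ + 1 ∧ Y.indexP = X.indexP) ∨
      (Y.indexQ = X.indexQ ∧ Y.indexP = X.indexP - 1)) : Nonempty (X ⟶ Y) := by
  rcases h with h | h
  · obtain ⟨Z, hZ, h1, h2⟩ := exists_arrow_indexQ hgn X
    rwa [NVertex.ext_index (X := Y) (Y := Z) (by omega) (by omega)]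
  · obtain ⟨Z, hZ, h1, h2⟩ := exists_arrow_indexP hgn X
    rwa [NVertex.ext_index (X := Y) (Y := Z) (by omega) (by omega)]

/-! ### Morphisms of `k(ℕK̃)` -/

/-- The vertex `X` as an object of `k(ℕK̃)`. -/
noncomputable def meshObj (k : Type u) [Field k] {n g : ℕ} (X : NVertex n g) : MeshCat k n g :=
  (CategoryTheory.Quotient.functor (meshRel k n g)).obj (PathAlg.of k X)

/-- A path of `ℕK̃` as a morphism of `kℕK̃`. -/
noncomputable def pathHom (k : Type u) [Field k] {n g : ℕ} {X Y : NVertex n g}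
    (f : Quiver.Path X Y) : PathAlg.of k X ⟶ PathAlg.of k Y :=
  (Free.embedding k (Paths (NVertex n g))).map (X := (Paths.of (NVertex n g)).obj X)
    (Y := (Paths.of (NVertex n g)).obj Y) f

/-- The class of a path of `ℕK̃` in `k(ℕK̃)`. -/
noncomputable def pathClass (k : Type u) [Field k] {n g : ℕ} {X Y : NVertex n g}
    (f : Quiver.Path X Y) : meshObj k X ⟶ meshObj k Y :=
  (CategoryTheory.Quotient.functor (meshRel k n g)).map (pathHom k f)

lemma pathClass_comp (k : Type u) [Field k] {n g : ℕ} {X Y Z : NVertex n g}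
    (f : Quiver.Path X Y) (f' : Quiver.Path Y Z) :
    pathClass k (f.comp f') = pathClass k f ≫ pathClass k f' :=
  (congrArg _ ((Free.embedding k (Paths (NVertex n g))).map_comp
    (X := (Paths.of (NVertex n g)).obj X) (Y := (Paths.of (NVertex n g)).obj Y)
    (Z := (Paths.of (NVertex n g)).obj Z) f f')).trans
      ((CategoryTheory.Quotient.functor (meshRel k n g)).map_comp (pathHom k f) (pathHom k f'))

lemma pathClass_cons (k : Type u) [Field k] {n g : ℕ} {X Y Z : NVertex n g}
    (f : Quiver.Path X Y) (γ : Y ⟶ Z) :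
    pathClass k (f.cons γ) = pathClass k f ≫ pathClass k γ.toPath :=
  pathClass_comp k f γ.toPath

lemma pathClass_diamond (k : Type u) [Field k] {n g : ℕ} {X Y₁ Y₂ Z : NVertex n g} (γ : X ⟶ Y₁)
    (γ' : Y₁ ⟶ Z) (δ : X ⟶ Y₂) (δ' : Y₂ ⟶ Z) (hY : Y₁ ≠ Y₂) :
    pathClass k γ.toPath ≫ pathClass k γ'.toPath =
      pathClass k δ.toPath ≫ pathClass k δ'.toPath := by
  rw [← pathClass_comp, ← pathClass_comp]
  refine CategoryTheory.Quotient.sound (meshRel k n g) ?_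
  have h : 𝟙 (PathAlg.of k X) ≫ (pathTwo k γ γ' - pathTwo k δ δ') ≫ 𝟙 (PathAlg.of k Z) ∈
      meshIdeal k n g (PathAlg.of k X) (PathAlg.of k Z) :=
    Submodule.subset_span ⟨_, _, 𝟙 _, _, 𝟙 _, IsMeshElement.mk hY γ γ' δ δ', rfl⟩
  rwa [Category.id_comp, Category.comp_id] at h

/-- Parallel paths have the same class. -/
lemma pathClass_eq (k : Type u) [Field k] {n g : ℕ} (hgn : g ≤ n) {X Y : NVertex n g}
    (f f' : Quiver.Path X Y) : pathClass k f = pathClass k f' := by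
  obtain ⟨m, hm⟩ : ∃ m, f.length = m := ⟨_, rfl⟩
  induction m generalizing Y with
  | zero =>
    -- The indices of the endpoints determine the length, so `f'` is trivial as well.
    have h1 := (index_le_of_path hgn f).2.2
    have h2 := (index_le_of_path hgn f').2.2
    have hm' : f'.length = 0 := by omega
    obtain rfl := Quiver.Path.eq_of_length_zero f hm
    rw [Quiver.Path.eq_nil_of_length_zero f hm, Quiver.Path.eq_nil_of_length_zero f' hm']
  | succ m ih =>
    have h1 := index_le_of_path hgn f
    have h2 := index_le_of_path hgn f'
    cases f with
    | nil => simp at hm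
    | cons f γ =>
      cases f' with
      | nil => simp at h1 hm; omega
      | cons f' δ =>
        rename_i Z Z'
        rw [Quiver.Path.length_cons] at hm
        have hf1 := index_le_of_path hgn f
        have hf2 := index_le_of_path hgn f'
        have hγ := NArrow.index_cases hgn γ
        have hδ := NArrow.index_cases hgn δ
        by_cases hZ : Z = Z'
        · subst hZ
          rw [Subsingleton.elim δ γ, pathClass_cons, pathClass_cons, ih f f' (by omega)]
        · have hne : ¬ (Z.indexQ = Z'.indexQ ∧ Z.indexP = Z'.indexP) :=
            fun h => hZ (NVertex.ext_index h.1 h.2)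
          -- `Z` and `Z'` are the two distinct predecessors of `Y`, and `W` is the fourth corner of
          -- their square. It is a vertex and can be reached from `X`, because `f` and `f'` show
          -- that `X` is at least one step away from `Y` in each index.
          obtain ⟨W, hW1, hW2⟩ := exists_vertex_index hgn X (j := Y.indexQ - 1)
            (i := Y.indexP + 1) (by omega) (by omega)
          obtain ⟨w⟩ := exists_path hgn (X := X) (Y := W) (by omega) (by omega)
          obtain ⟨a⟩ := exists_arrow_of_index hgn (X := W) (Y := Z) (by omega)
          obtain ⟨a'⟩ := exists_arrow_of_index hgn (X := W) (Y := Z') (by omega)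
          -- By induction both truncated paths may be rerouted through `W`; the remaining square is
          -- a mesh relation.
          rw [pathClass_cons, pathClass_cons, ih f (w.cons a) (by omega),
            ih f' (w.cons a') (by omega), pathClass_cons, pathClass_cons, Category.assoc,
            Category.assoc, pathClass_diamond k a γ a' δ hZ]

lemma eq_smul_pathClass {k : Type u} [Field k] {n g : ℕ} (hgn : g ≤ n) {X Y : NVertex n g}
    (f : Quiver.Path X Y) (μ : meshObj k X ⟶ meshObj k Y) : ∃ t : k, μ = t • pathClass k f := by
  obtain ⟨μ, rfl⟩ := (CategoryTheory.Quotient.functor (meshRel k n g)).map_surjective μ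
  refine Finsupp.induction_linear μ ?_ (fun a b ha hb => ?_) (fun a t => ?_)
  · exact ⟨0, (Functor.map_zero _ _ _).trans (zero_smul _ _).symm⟩
  · obtain ⟨s, hs⟩ := ha
    obtain ⟨t, ht⟩ := hb
    exact ⟨s + t, (Functor.map_add _).trans ((congrArg₂ _ hs ht).trans (add_smul _ _ _).symm)⟩
  · refine ⟨t, ?_⟩
    rw [pathClass_eq k hgn f a]
    refine Eq.trans (congrArg _ ?_)
      ((CategoryTheory.Quotient.functor (meshRel k n g)).map_smul t (pathHom k a))
    exact (Finsupp.smul_single_one a t).symm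

lemma eq_zero_of_isEmpty_path {k : Type u} [Field k] {n g : ℕ} {X Y : NVertex n g}
    (h : ¬ Nonempty (Quiver.Path X Y)) (μ : meshObj k X ⟶ meshObj k Y) : μ = 0 := by
  obtain ⟨μ, rfl⟩ := (CategoryTheory.Quotient.functor (meshRel k n g)).map_surjective μ
  have : μ = 0 := Finsupp.ext fun a => (h ⟨a⟩).elim
  exact (congrArg _ this).trans (Functor.map_zero _ _ _)

/-! ### The functor `F̄` on paths -/

lemma shiftMap_zero (k : Type u) [Field k] {n : ℕ} {p q c : ℤ} (hc : c = 0) (x : ZMod (n + 1)) :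
    shiftMap k p q p q c x = LinearMap.id := by
  subst hc
  refine Finsupp.lhom_ext' fun i => LinearMap.ext_ring ?_
  obtain ⟨i, h⟩ := i
  simp only [shiftMap, LinearMap.comp_apply, Finsupp.lsingle_apply,
    Finsupp.linearCombination_single, one_smul, add_zero, LinearMap.id_apply]
  exact basisVec_of h

/-- The shift is allowed to be zero only propositionally, because in `walkIncl` it is a difference
of two equal normalisation shifts. -/
lemma rawIncl_zero (k : Type u) [Field k] {n g : ℕ} {p q c : ℤ} (h0 : c = 0)
    (hc : ((n + 1 : ℕ) : ℤ) ∣ c) (hp : p ≤ p + c) (hq : q + c ≤ q)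
    (hP : (p - 1) % (n + 1 : ℕ) < (g : ℤ)) (hQ : (g : ℤ) ≤ q % (n + 1 : ℕ)) :
    rawIncl k c hc hp hq hP hQ = 𝟙 (rawWalkRep k n g p q) :=
  NatTrans.ext (funext fun x => ModuleCat.hom_ext (shiftMap_zero k h0 x))

lemma path_start_le {n g : ℕ} (hg : 1 ≤ g) (hgn : g ≤ n) {X Y : NVertex n g}
    (f : Quiver.Path X Y) :
    startP n g Y.r Y.s ≤ startP n g X.r X.s ∧ startQ n g X.r X.s ≤ startQ n g Y.r Y.s :=
  ⟨(startP_le_startP_iff hg hgn Y X).2 (index_le_of_path hgn f).2.1,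
    (startQ_le_startQ_iff hgn X Y).2 (index_le_of_path hgn f).1⟩

/-- Composites of maps `e_t ↦ e_t` have the same form, so the value depends only on the endpoints of
the path. -/
lemma functorFBar_pathClass (k : Type u) [Field k] {n g : ℕ} (hg : 1 ≤ g) (hgn : g ≤ n)
    {X Y : NVertex n g} (f : Quiver.Path X Y) :
    ((functorFBar k hg hgn).map (pathClass k f)).hom =
      walkIncl k (path_start_le hg hgn f).1 (path_start_le hg hgn f).2
        (startP_mod hg X.r X.s) (startQ_mod hgn X.r X.s) := by
  have h : (functorFBar k hg hgn).map (pathClass k f) =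
      (Paths.lift { obj := objF k hg hgn, map := fun γ => mapF k hg hgn γ }).map f :=
    (freeLiftMap_single k _ _ 1).trans (one_smul _ _)
  refine (congrArg InducedCategory.Hom.hom h).trans ?_
  clear h
  induction f with
  | nil => exact (rawIncl_zero k (by ring) _ _ _ _ _).symm
  | cons f γ ih =>
    rename_i Z Y
    refine (congrArg (· ≫ (mapF k hg hgn γ).hom) ih).trans ?_
    exact walkIncl_comp k _ _ _ _ (NArrow.startP_le hg γ) (NArrow.le_startQ hgn γ)
      (startP_mod hg Z.r Z.s) (startQ_mod hgn Z.r Z.s)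

/-! ### Morphisms between the representations of walks -/

/-- The coefficient of `e_j`, which is `0` by convention when `j` is not one of the indices of the
basis. -/
noncomputable def coord (k : Type u) [Field k] (n : ℕ) (p q : ℤ) (x : ZMod (n + 1)) (j : ℤ) :
    (Slot n p q x →₀ k) →ₗ[k] k :=
  open Classical in
  if h : p ≤ j ∧ j ≤ q ∧ (j : ZMod (n + 1)) = x then Finsupp.lapply ⟨j, h⟩ else 0

lemma coord_of {k : Type u} [Field k] {n : ℕ} {p q : ℤ} {x : ZMod (n + 1)} {j : ℤ}
    (h : p ≤ j ∧ j ≤ q ∧ (j : ZMod (n + 1)) = x) :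
    coord k n p q x j = Finsupp.lapply ⟨j, h⟩ := dif_pos h

lemma coord_eq_zero {k : Type u} [Field k] {n : ℕ} {p q : ℤ} {x : ZMod (n + 1)} {j : ℤ}
    (h : ¬ (p ≤ j ∧ j ≤ q ∧ (j : ZMod (n + 1)) = x)) : coord k n p q x j = 0 := dif_neg h

lemma coord_basisVec (k : Type u) [Field k] {n : ℕ} {p q : ℤ} {x : ZMod (n + 1)} {i : ℤ}
    (h : p ≤ i ∧ i ≤ q ∧ (i : ZMod (n + 1)) = x) (j : ℤ) :
    coord k n p q x j (basisVec k n p q x i) = if i = j then 1 else 0 := by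
  rw [basisVec_of h]
  by_cases hj : p ≤ j ∧ j ≤ q ∧ (j : ZMod (n + 1)) = x
  · rw [coord_of hj, Finsupp.lapply_apply, Finsupp.single_apply]
    simp only [Subtype.mk.injEq]
  · rw [coord_eq_zero hj, if_neg (by rintro rfl; exact hj h), LinearMap.zero_apply]

lemma hom_ext_basisVec {k : Type u} [Field k] {n : ℕ} {p q : ℤ} {x : ZMod (n + 1)} {M : Type*}
    [AddCommGroup M] [Module k M] {φ ψ : (Slot n p q x →₀ k) →ₗ[k] M}
    (h : ∀ i, p ≤ i ∧ i ≤ q ∧ (i : ZMod (n + 1)) = x →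
      φ (basisVec k n p q x i) = ψ (basisVec k n p q x i)) : φ = ψ := by
  refine Finsupp.lhom_ext' fun i => LinearMap.ext_ring ?_
  have := h i.1 i.2
  rwa [basisVec_of i.2] at this

lemma eq_zero_of_coord {k : Type u} [Field k] {n : ℕ} {p q : ℤ} {x : ZMod (n + 1)}
    {v : Slot n p q x →₀ k} (h : ∀ j, coord k n p q x j v = 0) : v = 0 :=
  Finsupp.ext fun i => by
    have := h i.1
    rwa [coord_of i.2] at this

lemma lt_of_val_lt {n g : ℕ} {q i : ℤ} (hQ : (g : ℤ) ≤ q % (n + 1 : ℕ)) (hi : i ≤ q)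
    (h : (i : ZMod (n + 1)).val < g) : i < q := by
  refine hi.lt_of_ne fun e => ?_
  subst e
  have := intCast_val n i
  omega

lemma le_of_le_val {n g : ℕ} {p i : ℤ} (hP : (p - 1) % (n + 1 : ℕ) < (g : ℤ)) (hi : p ≤ i + 1)
    (h : g ≤ (i : ZMod (n + 1)).val) : p ≤ i := by
  by_contra hlt
  obtain rfl : p = i + 1 := by omega
  rw [add_sub_cancel_right] at hP
  have := intCast_val n i
  omega

lemma arrowMap_beta_basisVec (k : Type u) [Field k] {n g : ℕ} {p q i : ℤ} {x : ZMod (n + 1)}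
    (hQ : (g : ℤ) ≤ q % (n + 1 : ℕ)) (hx : x.val < g)
    (h : p ≤ i ∧ i ≤ q ∧ (i : ZMod (n + 1)) = x) :
    arrowMap k p q (KArrow.beta (g := g) x hx) (basisVec k n p q x i) =
      basisVec k n p q (x + 1) (i + 1) := by
  rw [basisVec_of h]
  refine (Finsupp.linearCombination_single k _ _).trans ((one_smul _ _).trans (if_pos ?_))
  exact lt_of_val_lt hQ h.2.1 (by rwa [h.2.2])

lemma arrowMap_alpha_basisVec (k : Type u) [Field k] {n g : ℕ} {p q i : ℤ} {x : ZMod (n + 1)}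
    (hx : g ≤ x.val) (hi : p ≤ i)
    (h : p ≤ i + 1 ∧ i + 1 ≤ q ∧ ((i + 1 : ℤ) : ZMod (n + 1)) = x + 1) :
    arrowMap k p q (KArrow.alpha (g := g) x hx) (basisVec k n p q (x + 1) (i + 1)) =
      basisVec k n p q x i := by
  rw [basisVec_of h]
  refine (Finsupp.linearCombination_single k _ _).trans ((one_smul _ _).trans ?_)
  simp only [add_sub_cancel_right]
  exact if_pos (by omega)

/-- No basis vector is killed: `e_q` lies at a residue at least `g`, where no `β` starts. The
default value `0` of `coord` makes the identity valid for all `j`. -/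
lemma coord_arrowMap_beta (k : Type u) [Field k] {n g : ℕ} {p q : ℤ} {x : ZMod (n + 1)}
    (hQ : (g : ℤ) ≤ q % (n + 1 : ℕ)) (hx : x.val < g) (j : ℤ) (v : Slot n p q x →₀ k) :
    coord k n p q (x + 1) (j + 1) (arrowMap k p q (KArrow.beta (g := g) x hx) v) =
      coord k n p q x j v := by
  rw [← LinearMap.comp_apply]
  congr 1
  refine hom_ext_basisVec fun i h => ?_
  have hi := lt_of_val_lt hQ h.2.1 (by rwa [h.2.2])
  rw [LinearMap.comp_apply, arrowMap_beta_basisVec k hQ hx h, coord_basisVec k h,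
    coord_basisVec k ⟨by omega, by omega, by push_cast; rw [h.2.2]⟩]
  simp only [add_left_inj]

/-- No basis vector is killed: an `α` acting on `e_p` would end at the residue of `p - 1`, which is
less than `g`. -/
lemma coord_arrowMap_alpha (k : Type u) [Field k] {n g : ℕ} {p q : ℤ} {x : ZMod (n + 1)}
    (hP : (p - 1) % (n + 1 : ℕ) < (g : ℤ)) (hx : g ≤ x.val) (j : ℤ)
    (v : Slot n p q (x + 1) →₀ k) :
    coord k n p q x j (arrowMap k p q (KArrow.alpha (g := g) x hx) v) =
      coord k n p q (x + 1) (j + 1) v := by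
  rw [← LinearMap.comp_apply]
  congr 1
  refine hom_ext_basisVec fun i h => ?_
  obtain ⟨i, rfl⟩ : ∃ i', i = i' + 1 := ⟨i - 1, by omega⟩
  have hix : (i : ZMod (n + 1)) = x := by
    have := h.2.2
    push_cast at this
    exact add_right_cancel this
  have hi := le_of_le_val hP h.1 (by rwa [hix])
  rw [LinearMap.comp_apply, arrowMap_alpha_basisVec k hx hi h, coord_basisVec k h,
    coord_basisVec k ⟨by omega, by omega, hix⟩]
  simp only [add_left_inj]

/-! ### Matrix entries of a morphism and their constancy along diagonals -/

/-- The component at `x` of a morphism between representations of walks. -/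
noncomputable def component {k : Type u} [Field k] {n g : ℕ} {p q p' q' : ℤ}
    (f : rawWalkRep k n g p q ⟶ rawWalkRep k n g p' q') (x : ZMod (n + 1)) :
    (Slot n p q x →₀ k) →ₗ[k] (Slot n p' q' x →₀ k) :=
  (f.app ((Paths.of (KVertex n g)).obj x)).hom

lemma component_arrowMap {k : Type u} [Field k] {n g : ℕ} {p q p' q' : ℤ}
    (f : rawWalkRep k n g p q ⟶ rawWalkRep k n g p' q') {x y : ZMod (n + 1)} (γ : KArrow n g x y)
    (v : Slot n p q x →₀ k) :
    component f y (arrowMap k p q γ v) = arrowMap k p' q' γ (component f x v) := by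
  have h := f.naturality ((Paths.of (KVertex n g)).map (X := x) (Y := y) γ)
  have h1 : ∀ p q, (rawWalkRep k n g p q).map
      ((Paths.of (KVertex n g)).map (X := x) (Y := y) γ) = ModuleCat.ofHom (arrowMap k p q γ) :=
    fun p q => Paths.lift_toPath _ _
  rw [h1, h1] at h
  exact LinearMap.congr_fun (congrArg ModuleCat.Hom.hom h) v

/-- The coefficient of `e_j` in the image of `e_i`, where `i ≡ x`. -/
noncomputable def entry {k : Type u} [Field k] {n g : ℕ} {p q p' q' : ℤ}
    (f : rawWalkRep k n g p q ⟶ rawWalkRep k n g p' q') (x : ZMod (n + 1)) (i j : ℤ) : k :=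
  coord k n p' q' x j (component f x (basisVec k n p q x i))

/-- Exactly one arrow joins `x` and `x + 1`. Naturality along it, in whichever direction it points,
identifies the two entries. -/
lemma entry_succ {k : Type u} [Field k] {n g : ℕ} {p q p' q' : ℤ}
    (hQ : (g : ℤ) ≤ q % (n + 1 : ℕ))
    (hP' : (p' - 1) % (n + 1 : ℕ) < (g : ℤ)) (hQ' : (g : ℤ) ≤ q' % (n + 1 : ℕ))
    (f : rawWalkRep k n g p q ⟶ rawWalkRep k n g p' q') {x : ZMod (n + 1)} {i : ℤ} (hp : p ≤ i)
    (hq : i + 1 ≤ q) (hx : (i : ZMod (n + 1)) = x) (j : ℤ) :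
    entry f (x + 1) (i + 1) (j + 1) = entry f x i j := by
  unfold entry
  rcases lt_or_ge x.val g with h | h
  · rw [← arrowMap_beta_basisVec k hQ h ⟨hp, by omega, hx⟩, component_arrowMap,
      coord_arrowMap_beta k hQ']
  · rw [← coord_arrowMap_alpha k hP' h, ← component_arrowMap, arrowMap_alpha_basisVec k h hp
      ⟨by omega, hq, by push_cast; rw [hx]⟩]

lemma entry_eq {k : Type u} [Field k] {n g : ℕ} {p q p' q' : ℤ}
    (hQ : (g : ℤ) ≤ q % (n + 1 : ℕ))
    (hP' : (p' - 1) % (n + 1 : ℕ) < (g : ℤ)) (hQ' : (g : ℤ) ≤ q' % (n + 1 : ℕ))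
    (f : rawWalkRep k n g p q ⟶ rawWalkRep k n g p' q') (d : ℤ) {i : ℤ} (hp : p ≤ i) :
    i ≤ q → ∀ x : ZMod (n + 1), (i : ZMod (n + 1)) = x →
      entry f x i (i + d) = entry f p p (p + d) := by
  induction i, hp using Int.leInduction with
  | base => rintro - x rfl; rfl
  | succ i hi ih =>
    rintro hq x rfl
    rw [← ih (by omega) i rfl, ← entry_succ hQ hP' hQ' f hi hq rfl, add_right_comm]
    push_cast
    rfl

/-- The coefficient of `e_{p+d}` in the image of `e_p`, as a linear form on morphisms. -/
noncomputable def shiftCoeff (k : Type u) [Field k] (n g : ℕ) (p q p' q' d : ℤ) :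
    (rawWalkRep k n g p q ⟶ rawWalkRep k n g p' q') →ₗ[k] k where
  toFun f := entry f p p (p + d)
  map_add' _ _ := map_add (coord k n p' q' p (p + d)) _ _
  map_smul' t _ := map_smul (coord k n p' q' p (p + d)) t _

/-- The diagonal runs from `(p, p + d)` to `(q, q + d)` with constant value. If this value is
nonzero, both `e_{p+d}` and `e_{q+d}` must be basis vectors of the target at the right vertices. -/
lemma shiftCoeff_eq_zero {k : Type u} [Field k] {n g : ℕ} {p q p' q' d : ℤ} (hpq : p ≤ q)
    (hQ : (g : ℤ) ≤ q % (n + 1 : ℕ))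
    (hP' : (p' - 1) % (n + 1 : ℕ) < (g : ℤ)) (hQ' : (g : ℤ) ≤ q' % (n + 1 : ℕ))
    (h : ¬ (((n + 1 : ℕ) : ℤ) ∣ d ∧ p' ≤ p + d ∧ q + d ≤ q'))
    (f : rawWalkRep k n g p q ⟶ rawWalkRep k n g p' q') :
    shiftCoeff k n g p q p' q' d f = 0 := by
  change entry f p p (p + d) = 0
  by_cases h1 : p' ≤ p + d ∧ p + d ≤ q' ∧ ((p + d : ℤ) : ZMod (n + 1)) = p
  · rw [← entry_eq hQ hP' hQ' f d hpq le_rfl q rfl]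
    refine LinearMap.congr_fun (coord_eq_zero fun h2 => h ⟨?_, h1.1, h2.2.1⟩) _
    refine (ZMod.intCast_zmod_eq_zero_iff_dvd d (n + 1)).1 ?_
    have := h1.2.2
    push_cast at this
    exact add_eq_left.1 this
  · exact LinearMap.congr_fun (coord_eq_zero h1) _

lemma eq_zero_of_shiftCoeff {k : Type u} [Field k] {n g : ℕ} {p q p' q' : ℤ}
    (hQ : (g : ℤ) ≤ q % (n + 1 : ℕ))
    (hP' : (p' - 1) % (n + 1 : ℕ) < (g : ℤ)) (hQ' : (g : ℤ) ≤ q' % (n + 1 : ℕ))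
    {f : rawWalkRep k n g p q ⟶ rawWalkRep k n g p' q'}
    (h : ∀ d, shiftCoeff k n g p q p' q' d f = 0) : f = 0 := by
  refine NatTrans.ext (funext fun x => ModuleCat.hom_ext ?_)
  change component f x = 0
  refine hom_ext_basisVec fun i hi => eq_zero_of_coord fun j => ?_
  have := entry_eq hQ hP' hQ' f (j - i) hi.1 hi.2.1 x hi.2.2
  rw [add_sub_cancel] at this
  exact this.trans (h (j - i))

lemma shiftCoeff_rawIncl (k : Type u) [Field k] {n g : ℕ} {p q p' q' c : ℤ} (hpq : p ≤ q)
    (hc : ((n + 1 : ℕ) : ℤ) ∣ c) (hp : p' ≤ p + c) (hq : q + c ≤ q')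
    (hP : (p - 1) % (n + 1 : ℕ) < (g : ℤ)) (hQ : (g : ℤ) ≤ q % (n + 1 : ℕ)) (d : ℤ) :
    shiftCoeff k n g p q p' q' d (rawIncl k c hc hp hq hP hQ) = if c = d then 1 else 0 := by
  have hc0 : ((c : ℤ) : ZMod (n + 1)) = 0 := (ZMod.intCast_zmod_eq_zero_iff_dvd c (n + 1)).2 hc
  change coord k n p' q' p (p + d) (shiftMap k p q p' q' c p (basisVec k n p q p p)) = _
  have h : shiftMap k p q p' q' c p (basisVec k n p q p p) = basisVec k n p' q' p (p + c) := by
    rw [basisVec_of ⟨le_rfl, hpq, rfl⟩]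
    exact (Finsupp.linearCombination_single k _ _).trans (one_smul _ _)
  rw [h, coord_basisVec k ⟨hp, by omega, by push_cast; rw [hc0, add_zero]⟩]
  simp only [add_right_inj]

/-! ### The fibres of `F̄` -/

lemma IsPostProjectiveWalk.mod {n g : ℕ} (hgn : g ≤ n) {p q : ℤ}
    (h : IsPostProjectiveWalk n g p q) :
    (p - 1) % (n + 1 : ℕ) < (g : ℤ) ∧ (g : ℤ) ≤ q % (n + 1 : ℕ) := by
  obtain ⟨-, ⟨a, ha1, ha2, ha⟩, ⟨b, hb1, hb2, hb⟩⟩ := h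
  constructor
  · rw [(ha.sub_right 1 : (p - 1) % _ = _), Int.emod_eq_of_lt (by omega) (by push_cast; omega)]
    omega
  · rw [(hb : q % _ = _), Int.emod_eq_of_lt (by omega) (by push_cast; omega)]
    exact hb1

lemma sub_one_mod_of_dvd {n g : ℕ} {p p' : ℤ} (h : ((n + 1 : ℕ) : ℤ) ∣ p' - p)
    (hP : (p - 1) % (n + 1 : ℕ) < (g : ℤ)) : (p' - 1) % (n + 1 : ℕ) < (g : ℤ) := by
  rwa [← ((Int.modEq_iff_dvd.2 h).sub_right 1 : (p - 1) % _ = _)]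

lemma mod_of_dvd {n g : ℕ} {q q' : ℤ} (h : ((n + 1 : ℕ) : ℤ) ∣ q' - q)
    (hQ : (g : ℤ) ≤ q % (n + 1 : ℕ)) : (g : ℤ) ≤ q' % (n + 1 : ℕ) := by
  rwa [← (Int.modEq_iff_dvd.2 h : q % _ = _)]

/-- The representations of post-projective walks determine the walks up to translation. -/
lemma rawWalkRep_injective {k : Type u} [Field k] {n g : ℕ} {p q p' q' : ℤ}
    (hpq : p ≤ q) (hP : (p - 1) % (n + 1 : ℕ) < (g : ℤ)) (hQ : (g : ℤ) ≤ q % (n + 1 : ℕ))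
    (hpq' : p' ≤ q') (hP' : (p' - 1) % (n + 1 : ℕ) < (g : ℤ)) (hQ' : (g : ℤ) ≤ q' % (n + 1 : ℕ))
    (h : rawWalkRep k n g p q = rawWalkRep k n g p' q') :
    q' - p' = q - p ∧ ((n + 1 : ℕ) : ℤ) ∣ p' - p := by
  have ne : ∀ {p q : ℤ}, p ≤ q → (p - 1) % (n + 1 : ℕ) < (g : ℤ) → (g : ℤ) ≤ q % (n + 1 : ℕ) →
      𝟙 (rawWalkRep k n g p q) ≠ 0 := by
    intro p q hpq hP hQ h0
    have h1 := shiftCoeff_rawIncl k (p' := p) (q' := q) hpq (dvd_zero ((n + 1 : ℕ) : ℤ))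
      (by omega) (by omega) hP hQ 0
    rw [rawIncl_zero k rfl, h0, map_zero, if_pos rfl] at h1
    exact zero_ne_one h1
  -- Transport along the equality is invertible, hence nonzero, so at least one shift must be
  -- admissible.
  have key : ∀ {p q p' q' : ℤ}, p ≤ q → (p - 1) % (n + 1 : ℕ) < (g : ℤ) →
      (g : ℤ) ≤ q % (n + 1 : ℕ) → (p' - 1) % (n + 1 : ℕ) < (g : ℤ) →
      (g : ℤ) ≤ q' % (n + 1 : ℕ) → rawWalkRep k n g p q = rawWalkRep k n g p' q' →
      ∃ d, ((n + 1 : ℕ) : ℤ) ∣ d ∧ p' ≤ p + d ∧ q + d ≤ q' := by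
    intro p q p' q' hpq hP hQ hP' hQ' h
    by_contra hd
    push Not at hd
    have h0 : eqToHom h = 0 := eq_zero_of_shiftCoeff hQ hP' hQ' fun d =>
      shiftCoeff_eq_zero hpq hQ hP' hQ' (fun h' => (hd d h'.1 h'.2.1).not_ge h'.2.2) _
    have h1 := eqToHom_trans h h.symm
    rw [h0, Limits.zero_comp, eqToHom_refl] at h1
    exact ne hpq hP hQ h1.symm
  obtain ⟨d, h1, h2, h3⟩ := key hpq hP hQ hP' hQ' h
  obtain ⟨d', h1', h2', h3'⟩ := key hpq' hP' hQ' hP hQ h.symm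
  -- The left ends give `d + d' ≥ 0` and the right ends `d + d' ≤ 0`, so all four inequalities are
  -- equalities.
  obtain rfl : d = p' - p := by omega
  exact ⟨by omega, h1⟩

/-- This absorbs the identification of `V` with `F̄ X` that enters `fibreMap`. -/
lemma eqToHom_rawIncl (k : Type u) [Field k] {n g : ℕ} {p₀ q₀ p q p' q' c : ℤ}
    (hp₀ : p₀ = p) (hq₀ : q₀ = q) (h : rawWalkRep k n g p₀ q₀ = rawWalkRep k n g p q)
    (hc : ((n + 1 : ℕ) : ℤ) ∣ c) (hp : p' ≤ p + c) (hq : q + c ≤ q')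
    (hP : (p - 1) % (n + 1 : ℕ) < (g : ℤ)) (hQ : (g : ℤ) ≤ q % (n + 1 : ℕ)) :
    eqToHom h ≫ rawIncl k c hc hp hq hP hQ =
      rawIncl k c hc (by omega) (by omega) (by rwa [hp₀]) (by rwa [hq₀]) := by
  subst hp₀ hq₀
  rw [eqToHom_refl, Category.id_comp]

/-- `q'` in the normalisation `V_(p,q) = V_(p',q')`, `0 ≤ p' ≤ n`. -/
def normQ (n : ℕ) (p q : ℤ) : ℤ := q + p % (n + 1 : ℕ) - p

lemma mod_le_normQ (n : ℕ) {p q : ℤ} (h : p ≤ q) : p % (n + 1 : ℕ) ≤ normQ n p q := by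
  unfold normQ
  omega

lemma sub_one_mod_norm {n g : ℕ} {p : ℤ} (hP : (p - 1) % (n + 1 : ℕ) < (g : ℤ)) :
    (p % (n + 1 : ℕ) - 1) % (n + 1 : ℕ) < (g : ℤ) :=
  sub_one_mod_of_dvd (dvd_emod_sub n p) hP

lemma normQ_mod {n g : ℕ} {p q : ℤ} (hQ : (g : ℤ) ≤ q % (n + 1 : ℕ)) :
    (g : ℤ) ≤ normQ n p q % (n + 1 : ℕ) :=
  mod_of_dvd (by
    rw [normQ, show q + p % (n + 1 : ℕ) - p - q = p % (n + 1 : ℕ) - p by ring]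
    exact dvd_emod_sub n p) hQ

lemma walkRep_injective {k : Type u} [Field k] {n g : ℕ} {p q p' q' : ℤ}
    (hpq : p ≤ q) (hP : (p - 1) % (n + 1 : ℕ) < (g : ℤ)) (hQ : (g : ℤ) ≤ q % (n + 1 : ℕ))
    (hpq' : p' ≤ q') (hP' : (p' - 1) % (n + 1 : ℕ) < (g : ℤ)) (hQ' : (g : ℤ) ≤ q' % (n + 1 : ℕ))
    (h : walkRep k n g p q = walkRep k n g p' q') :
    p % (n + 1 : ℕ) = p' % (n + 1 : ℕ) ∧ normQ n p q = normQ n p' q' := by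
  have h1 := rawWalkRep_injective (mod_le_normQ n hpq) (sub_one_mod_norm hP) (normQ_mod hQ)
    (mod_le_normQ n hpq') (sub_one_mod_norm hP') (normQ_mod hQ') h
  have h2 : p % (n + 1 : ℕ) = p' % (n + 1 : ℕ) :=
    (Int.mod_modEq p _).symm.trans ((Int.modEq_iff_dvd.2 h1.2).trans (Int.mod_modEq p' _))
  exact ⟨h2, by omega⟩

/-- The coefficient of `e_{p+d}` in the image of `e_p` as a linear form on the morphisms of
`P`, with respect to the normalised walks. -/
noncomputable def homCoeff (k : Type u) [Field k] {n g : ℕ} {p q p' q' : ℤ}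
    (h : IsPostProjectiveWalk n g p q) (h' : IsPostProjectiveWalk n g p' q') (d : ℤ) :
    (postProj k n g p q h ⟶ postProj k n g p' q' h') →ₗ[k] k where
  toFun f := shiftCoeff k n g (p % (n + 1 : ℕ)) (normQ n p q) (p' % (n + 1 : ℕ)) (normQ n p' q') d
    f.hom
  map_add' _ _ := map_add (shiftCoeff k n g _ _ _ _ d) _ _
  map_smul' t _ := map_smul (shiftCoeff k n g _ _ _ _ d) t _

lemma homCoeff_eq_zero {k : Type u} [Field k] {n g : ℕ} (hgn : g ≤ n) {p q p' q' : ℤ}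
    (h : IsPostProjectiveWalk n g p q) (h' : IsPostProjectiveWalk n g p' q') {d : ℤ}
    (hd : ¬ (((n + 1 : ℕ) : ℤ) ∣ d ∧ p' % (n + 1 : ℕ) ≤ p % (n + 1 : ℕ) + d ∧
      normQ n p q + d ≤ normQ n p' q')) (f : postProj k n g p q h ⟶ postProj k n g p' q' h') :
    homCoeff k h h' d f = 0 :=
  shiftCoeff_eq_zero (mod_le_normQ n h.1) (normQ_mod (h.mod hgn).2)
    (sub_one_mod_norm (h'.mod hgn).1) (normQ_mod (h'.mod hgn).2) hd _

lemma eq_zero_of_homCoeff {k : Type u} [Field k] {n g : ℕ} (hgn : g ≤ n) {p q p' q' : ℤ}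
    (h : IsPostProjectiveWalk n g p q) (h' : IsPostProjectiveWalk n g p' q')
    {f : postProj k n g p q h ⟶ postProj k n g p' q' h'} (hf : ∀ d, homCoeff k h h' d f = 0) :
    f = 0 :=
  ObjectProperty.hom_ext _ (eq_zero_of_shiftCoeff (normQ_mod (h.mod hgn).2)
    (sub_one_mod_norm (h'.mod hgn).1) (normQ_mod (h'.mod hgn).2) hf)

/-- The difference of the normalisation shifts of `F Y` and `F X`. -/
def shiftOf {n g : ℕ} (X Y : NVertex n g) : ℤ :=
  (startP n g Y.r Y.s % (n + 1 : ℕ) - startP n g Y.r Y.s) -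
    (startP n g X.r X.s % (n + 1 : ℕ) - startP n g X.r X.s)

lemma start_of_objF_eq {k : Type u} [Field k] {n g : ℕ} (hg : 1 ≤ g) (hgn : g ≤ n) {p q : ℤ}
    (h : IsPostProjectiveWalk n g p q) {X : NVertex n g}
    (hX : objF k hg hgn X = postProj k n g p q h) :
    p % (n + 1 : ℕ) = startP n g X.r X.s % (n + 1 : ℕ) ∧
      normQ n p q = normQ n (startP n g X.r X.s) (startQ n g X.r X.s) :=
  walkRep_injective h.1 (h.mod hgn).1 (h.mod hgn).2 (isPostProjectiveWalk_start hg hgn X.r X.s).1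
    (startP_mod hg X.r X.s) (startQ_mod hgn X.r X.s) (congrArg (fun V => V.obj) hX.symm)

/-- Vertices of one fibre share the normalised walk, so the normalisation shift alone recovers both
starting points. -/
lemma eq_of_shiftOf_eq {k : Type u} [Field k] {n g : ℕ} (hg : 1 ≤ g) (hgn : g ≤ n) {p q : ℤ}
    (h : IsPostProjectiveWalk n g p q) {X X' Y : NVertex n g}
    (hX : objF k hg hgn X = postProj k n g p q h) (hX' : objF k hg hgn X' = postProj k n g p q h)
    (hs : shiftOf X Y = shiftOf X' Y) : X = X' := by
  have h1 := start_of_objF_eq hg hgn h hX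
  have h2 := start_of_objF_eq hg hgn h hX'
  unfold normQ at h1 h2
  unfold shiftOf at hs
  exact NVertex.ext_start hg hgn (by omega) (by omega)

lemma homCoeff_pathClass {k : Type u} [Field k] {n g : ℕ} (hg : 1 ≤ g) (hgn : g ≤ n) {p q : ℤ}
    (h : IsPostProjectiveWalk n g p q) {X Y : NVertex n g}
    (hX : (functorFBar k hg hgn).obj (meshObj k X) = postProj k n g p q h)
    (f : Quiver.Path X Y) (d : ℤ) :
    homCoeff k h (isPostProjectiveWalk_start hg hgn Y.r Y.s) d
      (eqToHom hX.symm ≫ (functorFBar k hg hgn).map (pathClass k f)) =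
        if shiftOf X Y = d then 1 else 0 := by
  obtain ⟨hp, hq⟩ := start_of_objF_eq hg hgn h hX
  refine Eq.trans (congrArg (shiftCoeff k n g _ _ _ _ d) ?_)
    (shiftCoeff_rawIncl k (c := shiftOf X Y) (mod_le_normQ n h.1) (dvd_shift n _ _) ?_ ?_
      (sub_one_mod_norm (h.mod hgn).1) (normQ_mod (h.mod hgn).2) d)
  · refine Eq.trans (congrArg₂ (· ≫ ·) (ObjectProperty.eqToHom_hom _)
      (functorFBar_pathClass k hg hgn f)) ?_
    exact eqToHom_rawIncl k hp hq _ _ _ _ _ _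

/-- The morphisms `e_i ↦ e_{i+d}` come from paths of `ℕK̃`. -/
lemma exists_path_shiftOf {k : Type u} [Field k] {n g : ℕ} (hg : 1 ≤ g) (hgn : g ≤ n) {p q : ℤ}
    (h : IsPostProjectiveWalk n g p q) (Y : NVertex n g) {d : ℤ} (hd : ((n + 1 : ℕ) : ℤ) ∣ d)
    (hp : startP n g Y.r Y.s % (n + 1 : ℕ) ≤ p % (n + 1 : ℕ) + d)
    (hq : normQ n p q + d ≤ normQ n (startP n g Y.r Y.s) (startQ n g Y.r Y.s)) :
    ∃ X : NVertex n g, objF k hg hgn X = postProj k n g p q h ∧ shiftOf X Y = d ∧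
      Nonempty (Quiver.Path X Y) := by
  -- `c` solves `shiftOf X Y = d` for a vertex `X` with walk `(p + c, q + c)`. The bounds on `d`
  -- then say that this walk lies inside that of `Y`.
  obtain ⟨c, hc⟩ : ∃ c, c = (p % (n + 1 : ℕ) - p) + d -
    (startP n g Y.r Y.s % (n + 1 : ℕ) - startP n g Y.r Y.s) := ⟨_, rfl⟩
  have hdvd : ((n + 1 : ℕ) : ℤ) ∣ c :=
    hc ▸ dvd_sub (dvd_add (dvd_emod_sub n p) hd) (dvd_emod_sub n _)
  obtain ⟨X, hX1, hX2⟩ := exists_vertex hg hgn (p := p + c) (q := q + c)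
    (by have := h.1; omega) (sub_one_mod_of_dvd (by rwa [add_sub_cancel_left]) (h.mod hgn).1)
    (mod_of_dvd (by rwa [add_sub_cancel_left]) (h.mod hgn).2)
  have hmod : (p + c) % (n + 1 : ℕ) = p % (n + 1 : ℕ) := by
    obtain ⟨e, rfl⟩ := hdvd
    exact Int.add_mul_emod_self_left _ _ _
  unfold normQ at hq
  refine ⟨X, ObjectProperty.FullSubcategory.ext ?_, ?_, ?_⟩
  · change rawWalkRep k n g _ _ = rawWalkRep k n g _ _
    rw [hX1, hX2, hmod]
    congr 1
    ring
  · unfold shiftOf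
    rw [hX1, hmod]
    omega
  · exact exists_path hgn ((startQ_le_startQ_iff hgn X Y).1 (by omega))
      ((startP_le_startP_iff hg hgn Y X).1 (by omega))

/-! ### Bijectivity of the map from the direct sum -/

/-- The summands of the source of `fibreMap`. -/
abbrev FibreHom {k : Type u} [Field k] {n g : ℕ} (hg : 1 ≤ g) (hgn : g ≤ n) {p q : ℤ}
    (h : IsPostProjectiveWalk n g p q) (Y : NVertex n g)
    (X : {X : MeshCat k n g // (functorFBar k hg hgn).obj X = postProj k n g p q h}) : Type u :=
  X.1 ⟶ meshObj k Y

/-- The linear form `homCoeff` on the source of `fibreMap`. -/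
noncomputable def fibreCoeff {k : Type u} [Field k] {n g : ℕ} (hg : 1 ≤ g) (hgn : g ≤ n) {p q : ℤ}
    (h : IsPostProjectiveWalk n g p q) (Y : NVertex n g) (d : ℤ) :
    DirectSum _ (FibreHom (k := k) hg hgn h Y) →ₗ[k] k :=
  homCoeff k h (isPostProjectiveWalk_start hg hgn Y.r Y.s) d ∘ₗ
    fibreMap k hg hgn (postProj k n g p q h) (meshObj k Y)

lemma fibreCoeff_lof {k : Type u} [Field k] {n g : ℕ} (hg : 1 ≤ g) (hgn : g ≤ n) {p q : ℤ}
    (h : IsPostProjectiveWalk n g p q) {X Y : NVertex n g}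
    [DecidableEq {X : MeshCat k n g // (functorFBar k hg hgn).obj X = postProj k n g p q h}]
    (hX : (functorFBar k hg hgn).obj (meshObj k X) = postProj k n g p q h)
    (f : Quiver.Path X Y) (d : ℤ) :
    fibreCoeff hg hgn h Y d (DirectSum.lof k _ (FibreHom hg hgn h Y) ⟨meshObj k X, hX⟩ (pathClass k f)) =
        if shiftOf X Y = d then 1 else 0 :=
  (congrArg (homCoeff k h (isPostProjectiveWalk_start hg hgn Y.r Y.s) d)
    (fibreMap_lof k hg hgn _ _ _ _)).trans (homCoeff_pathClass hg hgn h hX f d)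

/-- A linear map on a direct sum that vanishes on all summands but one factors through it. -/
lemma directSum_apply_eq_lof {R ι N : Type*} {M : ι → Type*} [Semiring R] [DecidableEq ι]
    [∀ i, AddCommMonoid (M i)] [∀ i, Module R (M i)] [AddCommMonoid N] [Module R N]
    (φ : DirectSum ι M →ₗ[R] N) (i : ι) (h : ∀ j ≠ i, ∀ μ, φ (DirectSum.lof R ι M j μ) = 0)
    (ξ : DirectSum ι M) : φ ξ = φ (DirectSum.lof R ι M i (ξ i)) := by
  have key : φ = φ ∘ₗ DirectSum.lof R ι M i ∘ₗ DirectSum.component R ι M i := by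
    refine DirectSum.linearMap_ext R fun j => LinearMap.ext fun μ => ?_
    simp only [LinearMap.comp_apply]
    by_cases hj : j = i
    · subst hj
      rw [DirectSum.component.lof_self]
    · rw [h j hj, DirectSum.component.of, dif_neg hj, map_zero, map_zero]
  exact LinearMap.congr_fun key ξ

lemma fibreCoeff_lof_of_ne {k : Type u} [Field k] {n g : ℕ} (hg : 1 ≤ g) (hgn : g ≤ n) {p q : ℤ}
    (h : IsPostProjectiveWalk n g p q) {X Y : NVertex n g}
    [DecidableEq {X : MeshCat k n g // (functorFBar k hg hgn).obj X = postProj k n g p q h}]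
    (hX : (functorFBar k hg hgn).obj (meshObj k X) = postProj k n g p q h) {d : ℤ}
    (hd : shiftOf X Y ≠ d) (μ : FibreHom hg hgn h Y ⟨meshObj k X, hX⟩) :
    fibreCoeff hg hgn h Y d (DirectSum.lof k _ (FibreHom hg hgn h Y) ⟨meshObj k X, hX⟩ μ) = 0 := by
  by_cases hpath : Nonempty (Quiver.Path X Y)
  · obtain ⟨f⟩ := hpath
    obtain ⟨t, rfl⟩ := eq_smul_pathClass hgn f μ
    have h1 := fibreCoeff_lof hg hgn h hX f d
    rw [if_neg hd] at h1
    rw [map_smul, map_smul, h1, smul_zero]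
  · rw [eq_zero_of_isEmpty_path hpath μ, map_zero, map_zero]

lemma fibreMap_injective {k : Type u} [Field k] {n g : ℕ} (hg : 1 ≤ g) (hgn : g ≤ n) {p q : ℤ}
    (h : IsPostProjectiveWalk n g p q) (Y : NVertex n g) :
    Function.Injective (fibreMap k hg hgn (postProj k n g p q h) (meshObj k Y)) := by
  classical
  refine (injective_iff_map_eq_zero _).2 fun ξ hξ => DFinsupp.ext ?_
  rintro ⟨X, hX⟩
  obtain ⟨X, rfl⟩ : ∃ X' : NVertex n g, X = meshObj k X' := ⟨X.as, rfl⟩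
  by_cases hpath : Nonempty (Quiver.Path X Y)
  · obtain ⟨f⟩ := hpath
    obtain ⟨t, ht⟩ := eq_smul_pathClass hgn f (ξ ⟨meshObj k X, hX⟩)
    have h0 : fibreCoeff hg hgn h Y (shiftOf X Y) ξ = 0 :=
      (congrArg (homCoeff k h (isPostProjectiveWalk_start hg hgn Y.r Y.s) (shiftOf X Y)) hξ).trans
        (map_zero _)
    -- The form for the shift of `X` vanishes on every other summand, since shifts separate the
    -- vertices of the fibre. On `ξ` it therefore returns the coefficient `t` at `X`.
    have h1 := directSum_apply_eq_lof (fibreCoeff hg hgn h Y (shiftOf X Y)) ⟨meshObj k X, hX⟩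
      (by
        rintro ⟨X', hX'⟩ hne μ
        obtain ⟨X', rfl⟩ : ∃ X'' : NVertex n g, X' = meshObj k X'' := ⟨X'.as, rfl⟩
        refine fibreCoeff_lof_of_ne hg hgn h hX' (fun e => hne ?_) μ
        obtain rfl := eq_of_shiftOf_eq hg hgn h hX' hX e
        rfl) ξ
    rw [ht, map_smul, map_smul, fibreCoeff_lof hg hgn h hX f, if_pos rfl, h0, smul_eq_mul,
      mul_one] at h1
    rw [ht, ← h1, zero_smul]
    rfl
  · exact eq_zero_of_isEmpty_path hpath _

lemma fibreMap_surjective {k : Type u} [Field k] {n g : ℕ} (hg : 1 ≤ g) (hgn : g ≤ n) {p q : ℤ}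
    (h : IsPostProjectiveWalk n g p q) (Y : NVertex n g) :
    Function.Surjective (fibreMap k hg hgn (postProj k n g p q h) (meshObj k Y)) := by
  classical
  intro f
  let f : postProj k n g p q h ⟶ postProj k n g (startP n g Y.r Y.s) (startQ n g Y.r Y.s)
    (isPostProjectiveWalk_start hg hgn Y.r Y.s) := f
  let φ := homCoeff k h (isPostProjectiveWalk_start hg hgn Y.r Y.s)
  -- For admissible `d`, `ξ` is the class of a path that realises the shift by `d`. Keeping
  -- admissibility inside the existential lets `choose` produce a total function, with value
  -- irrelevant elsewhere.
  have key : ∀ d, ∃ ξ, (((n + 1 : ℕ) : ℤ) ∣ d ∧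
      startP n g Y.r Y.s % (n + 1 : ℕ) ≤ p % (n + 1 : ℕ) + d ∧
      normQ n p q + d ≤ normQ n (startP n g Y.r Y.s) (startQ n g Y.r Y.s)) →
        ∀ e, fibreCoeff (k := k) hg hgn h Y e ξ = if d = e then 1 else 0 := by
    intro d
    by_cases hd : ((n + 1 : ℕ) : ℤ) ∣ d ∧
      startP n g Y.r Y.s % (n + 1 : ℕ) ≤ p % (n + 1 : ℕ) + d ∧
      normQ n p q + d ≤ normQ n (startP n g Y.r Y.s) (startQ n g Y.r Y.s)
    · obtain ⟨X, hX, hs, ⟨f⟩⟩ := exists_path_shiftOf (k := k) hg hgn h Y hd.1 hd.2.1 hd.2.2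
      exact ⟨_, fun _ e => (fibreCoeff_lof hg hgn h hX f e).trans (by rw [hs])⟩
    · exact ⟨0, fun h' => (hd h').elim⟩
  choose ξ hξ using key
  -- The bounds on `d` confine the admissible shifts to a finite interval, so the expansion of `f`
  -- in shifts is a finite sum.
  let D := (Finset.Icc (startP n g Y.r Y.s % (n + 1 : ℕ) - p % (n + 1 : ℕ))
    (normQ n (startP n g Y.r Y.s) (startQ n g Y.r Y.s) - normQ n p q)).filter
      fun d => ((n + 1 : ℕ) : ℤ) ∣ d
  have hD : ∀ d, d ∈ D ↔ (((n + 1 : ℕ) : ℤ) ∣ d ∧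
      startP n g Y.r Y.s % (n + 1 : ℕ) ≤ p % (n + 1 : ℕ) + d ∧
      normQ n p q + d ≤ normQ n (startP n g Y.r Y.s) (startQ n g Y.r Y.s)) := by
    intro d
    simp only [D, Finset.mem_filter, Finset.mem_Icc, sub_le_iff_le_add', le_sub_iff_add_le']
    tauto
  refine ⟨∑ d ∈ D, φ d f • ξ d, sub_eq_zero.1 ?_⟩
  -- Morphisms are compared by their coefficients. For `e` outside `D` both sides vanish, the
  -- right-hand one by `homCoeff_eq_zero`.
  refine eq_zero_of_homCoeff hgn h (isPostProjectiveWalk_start hg hgn Y.r Y.s) fun e => ?_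
  refine (map_sub (φ e) _ f).trans (sub_eq_zero.2 ?_)
  change fibreCoeff hg hgn h Y e (∑ d ∈ D, φ d f • ξ d) = φ e f
  rw [map_sum]
  have hsum : ∀ d ∈ D, fibreCoeff hg hgn h Y e (φ d f • ξ d) = if d = e then φ d f else 0 := by
    intro d hd
    rw [map_smul, hξ d ((hD d).1 hd) e, smul_eq_mul, mul_ite, mul_one, mul_zero]
  rw [Finset.sum_congr rfl hsum, Finset.sum_ite_eq' D e]
  split_ifs with he
  · rfl
  · exact (homCoeff_eq_zero hgn h _ (fun h' => he ((hD e).2 h')) f).symm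

end AffineA

theorem mainTheorem2 {k : Type u} [Field k] [IsAlgClosed k] {n g : ℕ} (hg : 1 ≤ g) (hgn : g ≤ n)
    (p q : ℤ) (hpq : AffineA.IsPostProjectiveWalk n g p q) (Y : AffineA.MeshCat k n g) :
    Function.Bijective (AffineA.fibreMap k hg hgn (AffineA.postProj k n g p q hpq) Y) :=
  ⟨AffineA.fibreMap_injective hg hgn hpq Y.as, AffineA.fibreMap_surjective hg hgn hpq Y.as⟩
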